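/- Let $N\ge 2$, $n=N^2-1$, and let $S_{kl}\in M_N(\mathbb{C})$ be the matrix units. Number elements $X_1,\dots,X_n$ of $\mathfrak{sl}(N,\mathbb{C})$ by $$X_m=S_{pq},\quad m=\tfrac{(N+q-1)(N-q)}{2}+p\quad(1\le p<q\le N),$$ $$X_m=S_{ll}-S_{l+1,l+1},\quad m=\tfrac{N(N-1)}{2}+l\quad(1\le l\le N-1),$$ $$X_m=S_{qp},\quad m=N^2-\tfrac{(N+q-1)(N-q)}{2}-p\quad(1\le p<q\le N).$$ For $1\le k\le N-1$ let $J_k=\{i_k,\dots,i_k+N-k-1\}$ with $i_k=N(k-1)-\frac{k(k-1)}2+1$ (the generators of the abelian subalgebra $\mathfrak{a}_k$: column $N-k+1$ above the diagonal), let $\widetilde J_k=\{j_k,\dots,j_k+N-k-1\}$ with $j_k=N(N-k)+\frac{k(k+1)}2$ (the generators of $\widetilde{\mathfrak{a}}_k$: row $N-k+1$ below the diagonal), and let $J_{\mathfrak h}=\{\frac{N(N-1)}2+1,\dots,\frac{N(N-1)}2+N-1\}$ (the Cartan generators). For $u\in\mathbb{C}^n$ put $K(u)=\exp(u_1X_1)\exp(u_2X_2)\cdots\exp(u_nX_n)$,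 and let $A(u)$ be the $n\times n$ matrix whose $l$-th column is the coordinate vector, in the basis $X$, of $\exp(u_1\mathrm{ad}_{X_1})\cdots\exp(u_{l-1}\mathrm{ad}_{X_{l-1}})X_l$. For $a\in\mathbb{C}^n$ put $M(a)=\sum_k a_kX_k$. Then: 1. This numbering defines a basis $X_1,\dots,X_n$ of $\mathfrak{sl}(N,\mathbb{C})$. 2. $A(u)$ is invertible for every $u$. If a curve $u(t)$ is differentiable at $t$, then $\frac{d}{dt}K(u(t))=M(a)K(u(t))$ at $t$ if and only if $u'(t)=A(u(t))^{-1}a$ (the Wei–Norman system). Moreover $K(0)=I$. 3. There are functions $c_i,C_{ij},b_i,f_i,h_i,L_{ij}$ of $(a,u)$, depending only on $N$, linear in $a$ and entire in $u$, such that for all $a,u,v\in\mathbb{C}^n$ the equation $v=A(u)^{-1}a$ is equivalent to the following hierarchy: * (matrix Riccati equations) for $1\le k\le N-1$ and $i\in J_k$, $$v_i=c_i+\sum_{j\in J_k}C_{ij}u_j+u_i\sum_{j\in J_k}u_jb_j,$$ where $c_i,C_{ij},b_j$ ($i,j\in J_k$) involve only $a$ and the unknowns $u_m$ with $m\in J_1\cup\dots\cup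 J_{k-1}$; * (Cartan unknowns) for $i\in J_{\mathfrak h}$, $v_i=f_i$, where $f_i$ involves only $a$ and the unknowns $u_m$ with $m\in J_1\cup\dots\cup J_{N-1}$; * (lower blocks, solved in the order $\widetilde{\mathfrak a}_{N-1},\dots,\widetilde{\mathfrak a}_1$) for $1\le k\le N-1$ and $i\in\widetilde J_k$, $$v_i=h_i+\sum_{l=k+1}^{N-1}\ \sum_{j\in\widetilde J_l}L_{ij}u_j,$$ where $h_i,L_{ij}$ involve only $a$ and the unknowns $u_m$ with $m\in J_1\cup\dots\cup J_{N-1}\cup J_{\mathfrak h}$. Consequently, if $I\ni 0$ is an open interval, $a$ is continuous on $I$, and $u(0)=0$, then $u'=A(u)^{-1}a$ on $I$ if and only if the upper unknowns solve the Riccati equations on $I$ and every Cartan and lower unknown is the integral from $0$ to $t$ of the corresponding right-hand side above. 4. (Restriction to $\mathfrak{su}(N)$.) $M(a)$ is anti-Hermitian if and only if $a_{N^2-m}=-\overline{a_m}$ for all $m\in J_1\cup\dots\cup J_{N-1}$ and $\overline{a_m}=-a_m$ for all $m\in J_{\mathfrak h}$. If $I\ni0$ is an open interval, $M(a(t))$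 is anti-Hermitian for all $t\in I$, $u(0)=0$ and $u'=A(u)^{-1}a$ on $I$, then $K(u(t))\in SU(N)$ for all $t\in I$. -/

import Mathlib

/-! ### The Wei–Norman system of a finite-dimensional complex Lie algebra -/

section WeiNorman

variable {n : ℕ} {𝔤 : Type*} [LieRing 𝔤] [LieAlgebra ℂ 𝔤]

/-- The matrix, in the basis `X`, of `A⁽ˡ⁾ = ∏_{k < l} exp (u_k ad X_k)`, the factors being taken
in increasing order of `k` from left to right. -/
noncomputable def wnPartialProduct (X : Module.Basis (Fin n) ℂ 𝔤) (u : Fin n → ℂ) (l : Fin n) :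
    Matrix (Fin n) (Fin n) ℂ :=
  (((List.finRange n).take l).map fun k =>
    NormedSpace.exp (u k • LinearMap.toMatrix X X (LieAlgebra.ad ℂ 𝔤 (X k)))).prod

/-- The Wei–Norman matrix `A(u)`: its `l`-th column is the `l`-th column of `A⁽ˡ⁾`, i.e. the
coordinate vector of `A⁽ˡ⁾ X_l`. -/
noncomputable def wnMatrix (X : Module.Basis (Fin n) ℂ 𝔤) (u : Fin n → ℂ) :
    Matrix (Fin n) (Fin n) ℂ :=
  Matrix.of fun j l => wnPartialProduct X u l j l

end WeiNorman

/-! ### The ordered basis of `sl(N, ℂ)`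

Below, the numbers `1, …, N² - 1` of the basis elements and `1, …, N` of the standard basis of
`ℂᴺ` are the values of the elements of `Fin (N ^ 2 - 1)` and `Fin N` increased by one. -/

/-- The number of `S_{pq}`, `1 ≤ p < q ≤ N`. -/
def upperNumber (N p q : ℕ) : ℕ := (N + q - 1) * (N - q) / 2 + p

/-- The number of `S_{ll} - S_{l+1,l+1}`, `1 ≤ l ≤ N - 1`. -/
def cartanNumber (N l : ℕ) : ℕ := N * (N - 1) / 2 + l

/-- The number of `S_{qp}`, `1 ≤ p < q ≤ N`. -/
def lowerNumber (N p q : ℕ) : ℕ := N ^ 2 - upperNumber N p q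

/-- The index type of the basis. -/
abbrev WNIndex (N : ℕ) : Type := Fin (N ^ 2 - 1)

/-- `sl(N, ℂ)`. -/
abbrev SLC (N : ℕ) : Type := LieAlgebra.SpecialLinear.sl (Fin N) ℂ

/-- `X` is the basis of `sl(N, ℂ)` made of the upper root vectors column by column, the last column
first, then the Cartan generators, then the lower root vectors in the reverse order. -/
structure IsWNBasis (N : ℕ) (X : Module.Basis (WNIndex N) ℂ (SLC N)) : Prop where
  upper : ∀ p q : Fin N, p < q → ∀ m : WNIndex N,
    (m : ℕ) + 1 = upperNumber N (p + 1) (q + 1) →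
      (X m : Matrix (Fin N) (Fin N) ℂ) = Matrix.single p q 1
  cartan : ∀ l l' : Fin N, (l' : ℕ) = l + 1 → ∀ m : WNIndex N,
    (m : ℕ) + 1 = cartanNumber N (l + 1) →
      (X m : Matrix (Fin N) (Fin N) ℂ) = Matrix.single l l 1 - Matrix.single l' l' 1
  lower : ∀ p q : Fin N, p < q → ∀ m : WNIndex N,
    (m : ℕ) + 1 = lowerNumber N (p + 1) (q + 1) →
      (X m : Matrix (Fin N) (Fin N) ℂ) = Matrix.single q p 1

/-- `M = ∑ a_k X_k`, as a matrix. -/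
noncomputable def wnGenerator {N : ℕ} (X : Module.Basis (WNIndex N) ℂ (SLC N))
    (a : WNIndex N → ℂ) : Matrix (Fin N) (Fin N) ℂ :=
  ∑ m, a m • (X m : Matrix (Fin N) (Fin N) ℂ)

/-- `K = exp (u_1 X_1) exp (u_2 X_2) ⋯`, in this order. -/
noncomputable def wnProduct {N : ℕ} (X : Module.Basis (WNIndex N) ℂ (SLC N))
    (u : WNIndex N → ℂ) : Matrix (Fin N) (Fin N) ℂ :=
  ((List.finRange (N ^ 2 - 1)).map fun m =>
    NormedSpace.exp (u m • (X m : Matrix (Fin N) (Fin N) ℂ))).prod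

/-! ### The blocks -/

/-- `J_k = {i_k, …, i_k + N - k - 1}`, `i_k = N(k-1) - k(k-1)/2 + 1`: the numbers of the generators
of the abelian subalgebra `𝔞_k` (column `N - k + 1` above the diagonal), `1 ≤ k ≤ N - 1`. -/
def upperBlock (N k : ℕ) : Finset (WNIndex N) :=
  Finset.univ.filter fun m =>
    (m : ℕ) + 1 ∈ Finset.Icc (N * (k - 1) - k * (k - 1) / 2 + 1)
      (N * (k - 1) - k * (k - 1) / 2 + 1 + (N - k - 1))

/-- The numbers of the generators of the Cartan subalgebra. -/
def cartanBlock (N : ℕ) : Finset (WNIndex N) :=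
  Finset.univ.filter fun m =>
    (m : ℕ) + 1 ∈ Finset.Icc (cartanNumber N 1) (cartanNumber N (N - 1))

/-- `J̃_k = {j_k, …, j_k + N - k - 1}`, `j_k = N(N-k) + k(k+1)/2`: the numbers of the generators of
the abelian subalgebra `𝔞̃_k` (row `N - k + 1` below the diagonal), `1 ≤ k ≤ N - 1`. -/
def lowerBlock (N k : ℕ) : Finset (WNIndex N) :=
  Finset.univ.filter fun m =>
    (m : ℕ) + 1 ∈ Finset.Icc (N * (N - k) + k * (k + 1) / 2)
      (N * (N - k) + k * (k + 1) / 2 + (N - k - 1))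

/-- The numbers of the unknowns that belong to `𝔞_1, …, 𝔞_{k-1}`. -/
def upperBefore (N k : ℕ) : Finset (WNIndex N) :=
  (Finset.Ico 1 k).biUnion (upperBlock N)

/-! ### The hierarchy -/

/-- A function of the coordinates `a` of `M` and of the unknowns `u` that is linear in `a`, entire
in `u`, and involves only the unknowns with numbers in `s`. -/
structure IsWNCoeff {n : ℕ} (s : Finset (Fin n)) (φ : (Fin n → ℂ) → (Fin n → ℂ) → ℂ) : Prop where
  linear : ∀ u, IsLinearMap ℂ fun a => φ a u
  entire : ∀ a, Differentiable ℂ (φ a)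
  dependsOn : ∀ a, DependsOn (φ a) (s : Set (Fin n))

/-- Coefficients of a hierarchy of Riccati equations for the blocks `𝔞_1, …, 𝔞_{N-1}`, of
integrations for the Cartan unknowns, and of linear equations for the blocks
`𝔞̃_{N-1}, …, 𝔞̃_1`; each coefficient involves only unknowns that come before. -/
structure WNHierarchy (N : ℕ) where
  /-- the inhomogeneous term of the Riccati equations -/
  c : WNIndex N → (WNIndex N → ℂ) → (WNIndex N → ℂ) → ℂ
  /-- the matrix of the linear term of the Riccati equations -/
  C : WNIndex N → WNIndex N → (WNIndex N → ℂ) → (WNIndex N → ℂ) → ℂ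
  /-- the vector in the quadratic term of the Riccati equations -/
  b : WNIndex N → (WNIndex N → ℂ) → (WNIndex N → ℂ) → ℂ
  /-- the derivatives of the Cartan unknowns -/
  f : WNIndex N → (WNIndex N → ℂ) → (WNIndex N → ℂ) → ℂ
  /-- the inhomogeneous term of the linear equations -/
  h : WNIndex N → (WNIndex N → ℂ) → (WNIndex N → ℂ) → ℂ
  /-- the matrix of the linear equations -/
  L : WNIndex N → WNIndex N → (WNIndex N → ℂ) → (WNIndex N → ℂ) → ℂ
  c_coeff : ∀ k ∈ Finset.Ico 1 N, ∀ i ∈ upperBlock N k, IsWNCoeff (upperBefore N k) (c i)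
  C_coeff : ∀ k ∈ Finset.Ico 1 N, ∀ i ∈ upperBlock N k, ∀ j ∈ upperBlock N k,
    IsWNCoeff (upperBefore N k) (C i j)
  b_coeff : ∀ k ∈ Finset.Ico 1 N, ∀ i ∈ upperBlock N k, IsWNCoeff (upperBefore N k) (b i)
  f_coeff : ∀ i ∈ cartanBlock N, IsWNCoeff (upperBefore N N) (f i)
  h_coeff : ∀ k ∈ Finset.Ico 1 N, ∀ i ∈ lowerBlock N k,
    IsWNCoeff (upperBefore N N ∪ cartanBlock N) (h i)
  L_coeff : ∀ k ∈ Finset.Ico 1 N, ∀ i ∈ lowerBlock N k,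
    ∀ l ∈ Finset.Ioo k N, ∀ j ∈ lowerBlock N l,
      IsWNCoeff (upperBefore N N ∪ cartanBlock N) (L i j)

namespace WNHierarchy

variable {N : ℕ} (H : WNHierarchy N)

/-- The component `i ∈ J_k` of `c + C u + u uᵀ b`, where `u` is the vector of the unknowns of the
block `𝔞_k`. -/
def riccati (k : ℕ) (i : WNIndex N) (a u : WNIndex N → ℂ) : ℂ :=
  H.c i a u + ∑ j ∈ upperBlock N k, H.C i j a u * u j + u i * ∑ j ∈ upperBlock N k, u j * H.b j a u

/-- The right-hand side for `i ∈ J̃_k`: affine in the unknowns of the lower blocks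
`𝔞̃_{N-1}, …, 𝔞̃_{k+1}` that come before. -/
def linearRhs (k : ℕ) (i : WNIndex N) (a u : WNIndex N → ℂ) : ℂ :=
  H.h i a u + ∑ l ∈ Finset.Ioo k N, ∑ j ∈ lowerBlock N l, H.L i j a u * u j

/-- `v` is the vector of the derivatives of the unknowns that the hierarchy prescribes. -/
structure Holds (a u v : WNIndex N → ℂ) : Prop where
  upper : ∀ k ∈ Finset.Ico 1 N, ∀ i ∈ upperBlock N k, v i = H.riccati k i a u
  cartan : ∀ i ∈ cartanBlock N, v i = H.f i a u
  lower : ∀ k ∈ Finset.Ico 1 N, ∀ i ∈ lowerBlock N k, v i = H.linearRhs k i a u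

/-- The curve `u` with `u 0 = 0` solves the hierarchy on `I`: the upper blocks solve their Riccati
equations, and all other unknowns are integrals of functions of unknowns that come before. -/
structure SolvedOn (a u : ℝ → WNIndex N → ℂ) (I : Set ℝ) : Prop where
  upper : ∀ k ∈ Finset.Ico 1 N, ∀ i ∈ upperBlock N k, ∀ t ∈ I,
    HasDerivAt (fun s => u s i) (H.riccati k i (a t) (u t)) t
  cartan : ∀ i ∈ cartanBlock N, ∀ t ∈ I, u t i = ∫ s in (0 : ℝ)..t, H.f i (a s) (u s)
  lower : ∀ k ∈ Finset.Ico 1 N, ∀ i ∈ lowerBlock N k, ∀ t ∈ I,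
    u t i = ∫ s in (0 : ℝ)..t, H.linearRhs k i (a s) (u s)

end WNHierarchy

/-!
# The Wei–Norman system of `sl(N, ℂ)` as a hierarchy of Riccati equations

Along every curve `K' = M(A(u) u') K`: differentiating a factor of `K` produces its generator
conjugated by the factors before it, and conjugation by `exp (u X)` is `exp (u ad X)`
(`hasDerivAt_wnProduct`). As `K` is invertible and `M` injective, the Wei–Norman system is the
equation `K' = M(a) K`.

The order of the basis makes `K` explicit. A root vector above the diagonal has product zero with
every later one above the diagonal, and the same holds below the diagonal; hence
`K = U D L` (`wnProduct_eq`), where `U = 1 + upperPart u` and `L = 1 + lowerPart u` are unipotent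
triangular matrices whose entries *are* the unknowns, and `D` is the diagonal matrix of the
exponentials of linear forms in the Cartan unknowns. With `B = U⁻¹ M U`, the system `A(u) v = a`
becomes
`U⁻¹ (upperPart v) + diag (diagPart v) + D (lowerPart v) L⁻¹ D⁻¹ = B`,
and the three summands are strictly upper triangular, diagonal and strictly lower triangular, so
that it splits (`wnMatrix_mulVec_eq_iff_parts`):

* `upperPart v = U (strictly upper part of B)`. In column `q` the right-hand side is
  `M U - ∑_{r ≥ q} U_{pr} B_{rq}`. The rows `r ≥ q` of `U⁻¹` involve only the columns of `U` after
  `q`, which are earlier unknowns, so the column `q` of `U` enters linearly through `M U` and `B`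
  and once more through the factor `U_{pq}` of `B_{qq}`: a Riccati equation
  (`upperFactor_mul_strictUpper_apply`).
* `diagPart v` is the diagonal of `B`, which has trace zero; the Cartan unknowns are recovered from
  its partial sums.
* `lowerPart v = D⁻¹ (strictly lower part of B) D L`, whose row `p` involves the rows of `L` before
  `p` only, and these linearly.

For `a = 0` all right-hand sides vanish, so `A(u)` is injective (`isUnit_wnMatrix`). The integral
form of the hierarchy follows from the fundamental theorem of calculus, block by block, because the
integrands only involve components already known to be continuous
(`WNHierarchy.hasDerivAt_holds_iff_solvedOn`). Finally `K` has determinant `1` by the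
factorization, and for anti-Hermitian `M` the derivative of `Kᴴ K` vanishes.

The numbering is handled through `wnRow` and `wnCol`, the position of a basis element in the matrix
(the Cartan generator `S_{pp} - S_{p+1,p+1}` is placed at `(p, p)`): the number is an injective
function on the positions other than the last diagonal one, and there are `N² - 1` of these.
-/

/-! ### The numbering -/

/-- The number, counted from `1`, of the basis element attached to the position `(p, q)`, rows and
columns being counted from `0`: a root vector off the diagonal, the Cartan generator
`S_{pp} - S_{p+1,p+1}` on it. The last diagonal position is not attached to a basis element. -/
def positionNumber (N p q : ℕ) : ℕ :=
  if p < q then upperNumber N (p + 1) (q + 1)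
  else if p = q then cartanNumber N (p + 1) else lowerNumber N (q + 1) (p + 1)

/-- `0 + 1 + ⋯ + q`. -/
def triangular (q : ℕ) : ℕ := q * (q + 1) / 2

theorem two_mul_triangular (q : ℕ) : 2 * triangular q = q * (q + 1) :=
  Nat.mul_div_cancel' (Nat.even_mul_succ_self q).two_dvd

theorem triangular_succ (q : ℕ) : triangular (q + 1) = triangular q + (q + 1) := by
  have h1 := two_mul_triangular q
  have h2 := two_mul_triangular (q + 1)
  nlinarith

theorem triangular_add_le {q q' : ℕ} (h : q < q') : triangular q + q' ≤ triangular q' := by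
  induction q', h using Nat.le_induction with
  | base => rw [triangular_succ]
  | succ k _ ih => rw [triangular_succ]; omega

theorem triangular_mono {q q' : ℕ} (h : q ≤ q') : triangular q ≤ triangular q' := by
  rcases h.eq_or_lt with rfl | h
  · rfl
  · have := triangular_add_le h
    omega

/-- The columns `q + 1, …, N - 1` have `triangular (N - 1) - triangular q` entries above the
diagonal. -/
theorem upperNumber_add_triangular {N q : ℕ} (p : ℕ) (hq : q < N) :
    upperNumber N (p + 1) (q + 1) + triangular q = triangular (N - 1) + p + 1 := by
  obtain ⟨d, rfl⟩ := Nat.exists_eq_add_of_lt hq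
  have h1 := two_mul_triangular q
  have h2 := two_mul_triangular (q + d)
  have h3 := two_mul_triangular d
  have e : (q + d + 1 + (q + 1) - 1) * (q + d + 1 - (q + 1)) = 2 * (q * d + triangular d) := by
    rw [show q + d + 1 + (q + 1) - 1 = 2 * q + d + 1 by omega,
      show q + d + 1 - (q + 1) = d by omega]
    nlinarith
  rw [upperNumber, e, Nat.mul_div_cancel_left _ two_pos, show q + d + 1 - 1 = q + d by omega]
  nlinarith

theorem cartanNumber_eq (N l : ℕ) : cartanNumber N l = triangular (N - 1) + l := by
  rw [cartanNumber, triangular]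
  rcases N with _ | N
  · simp
  · simp [mul_comm]

theorem sq_eq_two_mul_triangular {N : ℕ} (hN : 0 < N) :
    N ^ 2 = 2 * triangular (N - 1) + N := by
  obtain ⟨d, rfl⟩ := Nat.exists_eq_add_of_lt hN
  rw [two_mul_triangular]
  simp only [zero_add, Nat.add_sub_cancel]
  ring

theorem positionNumber_upper {N p q : ℕ} (hpq : p < q) (hq : q < N) :
    positionNumber N p q + triangular q = triangular (N - 1) + p + 1 := by
  rw [positionNumber, if_pos hpq, upperNumber_add_triangular p hq]

theorem positionNumber_diag (N p : ℕ) :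
    positionNumber N p p = triangular (N - 1) + p + 1 := by
  simp [positionNumber, cartanNumber_eq, add_assoc]

theorem positionNumber_lower {N p q : ℕ} (hqp : q < p) (hp : p < N) :
    positionNumber N p q + q + 1 = triangular (N - 1) + N + triangular p := by
  have h1 := upperNumber_add_triangular q hp
  have h2 := sq_eq_two_mul_triangular (show 0 < N by omega)
  have h3 := triangular_mono (show p ≤ N - 1 by omega)
  rw [positionNumber, if_neg (by omega), if_neg (by omega), lowerNumber]
  omega

theorem positionNumber_pos_le {N p q : ℕ} (hp : p < N) (hq : q < N)
    (h : ¬(p + 1 = N ∧ q + 1 = N)) :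
    1 ≤ positionNumber N p q ∧ positionNumber N p q ≤ N ^ 2 - 1 := by
  have h2 := sq_eq_two_mul_triangular (show 0 < N by omega)
  rcases lt_trichotomy p q with hpq | rfl | hpq
  · have h1 := positionNumber_upper hpq hq
    have h3 := triangular_mono (show q ≤ N - 1 by omega)
    have h4 := triangular_add_le hpq
    omega
  · have h1 := positionNumber_diag N p
    omega
  · have h1 := positionNumber_lower hpq hp
    have h3 := triangular_mono (show p ≤ N - 1 by omega)
    omega

theorem positionNumber_inj {N p q p' q' : ℕ} (hp : p < N) (hq : q < N) (hp' : p' < N)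
    (hq' : q' < N) (h : ¬(p + 1 = N ∧ q + 1 = N)) (h' : ¬(p' + 1 = N ∧ q' + 1 = N))
    (e : positionNumber N p q = positionNumber N p' q') : p = p' ∧ q = q' := by
  rcases lt_trichotomy p q with hpq | rfl | hpq <;>
    rcases lt_trichotomy p' q' with hpq' | rfl | hpq'
  · have h1 := positionNumber_upper hpq hq
    have h2 := positionNumber_upper hpq' hq'
    rcases lt_trichotomy q q' with hqq | rfl | hqq
    · have := triangular_add_le hqq
      omega
    · omega
    · have := triangular_add_le hqq
      omega
  · have h1 := positionNumber_upper hpq hq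
    have h2 := positionNumber_diag N p'
    have h3 := triangular_add_le hpq
    omega
  · have h1 := positionNumber_upper hpq hq
    have h2 := positionNumber_lower hpq' hp'
    have h3 := triangular_add_le hpq
    omega
  · have h1 := positionNumber_upper hpq' hq'
    have h2 := positionNumber_diag N p
    have h3 := triangular_add_le hpq'
    omega
  · have h1 := positionNumber_diag N p
    have h2 := positionNumber_diag N p'
    omega
  · have h1 := positionNumber_diag N p
    have h2 := positionNumber_lower hpq' hp'
    have h3 := triangular_add_le hpq'
    omega
  · have h1 := positionNumber_upper hpq' hq'
    have h2 := positionNumber_lower hpq hp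
    have h3 := triangular_add_le hpq'
    omega
  · have h1 := positionNumber_diag N p'
    have h2 := positionNumber_lower hpq hp
    have h3 := triangular_add_le hpq
    omega
  · have h1 := positionNumber_lower hpq hp
    have h2 := positionNumber_lower hpq' hp'
    rcases lt_trichotomy p p' with hqq | rfl | hqq
    · have := triangular_add_le hqq
      omega
    · omega
    · have := triangular_add_le hqq
      omega

/-- The positions in an `N × N` matrix other than the last one on the diagonal. -/
abbrev MatrixPosition (N : ℕ) : Type :=
  {x : Fin N × Fin N // ¬((x.1 : ℕ) + 1 = N ∧ (x.2 : ℕ) + 1 = N)}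

theorem card_matrixPosition (N : ℕ) : Fintype.card (MatrixPosition N) = N ^ 2 - 1 := by
  rcases N with _ | N
  · rfl
  · have : Fintype.card (MatrixPosition (N + 1)) =
        Fintype.card {x : Fin (N + 1) × Fin (N + 1) // x ≠ (Fin.last N, Fin.last N)} := by
      refine Fintype.card_congr (Equiv.subtypeEquivRight fun x => ?_)
      simp [Prod.ext_iff, Fin.ext_iff]
    rw [this, Fintype.card_subtype_compl]
    simp [sq]

/-- The index whose number is `positionNumber`. -/
def positionIndex (N : ℕ) (x : MatrixPosition N) : WNIndex N :=
  ⟨positionNumber N x.1.1 x.1.2 - 1, by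
    have := positionNumber_pos_le x.1.1.2 x.1.2.2 x.2
    omega⟩

theorem positionIndex_add_one (N : ℕ) (x : MatrixPosition N) :
    (positionIndex N x : ℕ) + 1 = positionNumber N x.1.1 x.1.2 := by
  have := positionNumber_pos_le x.1.1.2 x.1.2.2 x.2
  simp only [positionIndex]
  omega

theorem positionIndex_bijective (N : ℕ) : Function.Bijective (positionIndex N) := by
  refine (Fintype.bijective_iff_injective_and_card _).2 ⟨fun x y h => ?_, ?_⟩
  · have e : positionNumber N x.1.1 x.1.2 = positionNumber N y.1.1 y.1.2 := by
      rw [← positionIndex_add_one, ← positionIndex_add_one, h]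
    have := positionNumber_inj x.1.1.2 x.1.2.2 y.1.1.2 y.1.2.2 x.2 y.2 e
    exact Subtype.ext (Prod.ext (Fin.ext this.1) (Fin.ext this.2))
  · rw [card_matrixPosition, Fintype.card_fin]

/-- The position of the basis element with a given number. -/
noncomputable def wnPosition (N : ℕ) : WNIndex N ≃ MatrixPosition N :=
  (Equiv.ofBijective _ (positionIndex_bijective N)).symm

/-- The row of the basis element with number `m + 1`. -/
noncomputable def wnRow {N : ℕ} (m : WNIndex N) : Fin N := (wnPosition N m).1.1

/-- The column of the basis element with number `m + 1`. -/
noncomputable def wnCol {N : ℕ} (m : WNIndex N) : Fin N := (wnPosition N m).1.2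

section Position

variable {N : ℕ}

theorem wnPosition_not_last (m : WNIndex N) :
    ¬((wnRow m : ℕ) + 1 = N ∧ (wnCol m : ℕ) + 1 = N) := (wnPosition N m).2

theorem add_one_eq_positionNumber (m : WNIndex N) :
    (m : ℕ) + 1 = positionNumber N (wnRow m) (wnCol m) := by
  have := positionIndex_add_one N (wnPosition N m)
  rwa [show positionIndex N (wnPosition N m) = m from
    (Equiv.ofBijective _ (positionIndex_bijective N)).apply_symm_apply m] at this

theorem position_ext {m m' : WNIndex N} (hr : wnRow m = wnRow m') (hc : wnCol m = wnCol m') :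
    m = m' :=
  (wnPosition N).injective (Subtype.ext (Prod.ext hr hc))

theorem exists_position {p q : Fin N} (h : ¬((p : ℕ) + 1 = N ∧ (q : ℕ) + 1 = N)) :
    ∃ m : WNIndex N, wnRow m = p ∧ wnCol m = q := by
  refine ⟨(wnPosition N).symm ⟨(p, q), h⟩, ?_, ?_⟩ <;> simp [wnRow, wnCol]

theorem exists_position_of_ne {p q : Fin N} (h : p ≠ q) :
    ∃ m : WNIndex N, wnRow m = p ∧ wnCol m = q := by
  refine exists_position fun h' => h (Fin.ext ?_)
  omega

theorem position_of_number {m : WNIndex N} {p q : Fin N}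
    (h : ¬((p : ℕ) + 1 = N ∧ (q : ℕ) + 1 = N)) (e : (m : ℕ) + 1 = positionNumber N p q) :
    wnRow m = p ∧ wnCol m = q := by
  rw [add_one_eq_positionNumber] at e
  have := positionNumber_inj (wnRow m).2 (wnCol m).2 p.2 q.2 (wnPosition_not_last m) h e
  exact ⟨Fin.ext this.1, Fin.ext this.2⟩

/-- The transposed position has the complementary number. -/
theorem position_rev {m : WNIndex N} (h : wnRow m < wnCol m) :
    wnRow m.rev = wnCol m ∧ wnCol m.rev = wnRow m := by
  have h' : (wnRow m : ℕ) < wnCol m := h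
  have h1 := positionNumber_upper h' (wnCol m).2
  have h2 := positionNumber_lower h' (wnCol m).2
  have h3 := add_one_eq_positionNumber m
  have h4 := sq_eq_two_mul_triangular (show 0 < N from (wnRow m).pos)
  have := (wnCol m).2
  refine position_of_number (by omega) ?_
  rw [Fin.val_rev]
  have := m.2
  omega

/-- A basis element above the diagonal that comes after another one lies in the same column or
further to the left. -/
theorem wnCol_le_of_lt {m m' : WNIndex N} (h : wnRow m < wnCol m) (h' : wnRow m' < wnCol m')
    (hm : m < m') : wnCol m' ≤ wnCol m := by
  have h1 := positionNumber_upper h (wnCol m).2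
  have h2 := positionNumber_upper h' (wnCol m').2
  rw [← add_one_eq_positionNumber] at h1 h2
  by_contra! hc
  have := triangular_add_le (show (wnCol m : ℕ) < wnCol m' from hc)
  have : (m : ℕ) < m' := hm
  have : (wnRow m' : ℕ) < wnCol m' := h'
  omega

/-- A basis element below the diagonal that comes after another one lies in the same row or
further down. -/
theorem wnRow_le_of_lt {m m' : WNIndex N} (h : wnCol m < wnRow m) (h' : wnCol m' < wnRow m')
    (hm : m < m') : wnRow m ≤ wnRow m' := by
  have h1 := positionNumber_lower h (wnRow m).2
  have h2 := positionNumber_lower h' (wnRow m').2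
  rw [← add_one_eq_positionNumber] at h1 h2
  by_contra! hc
  have := triangular_add_le (show (wnRow m' : ℕ) < wnRow m from hc)
  have : (m : ℕ) < m' := hm
  have : (wnCol m : ℕ) < wnRow m := h
  omega

/-- The basis elements above the diagonal come first. -/
theorem upper_of_lt_upper {m m' : WNIndex N} (h' : wnRow m' < wnCol m') (hm : m < m') :
    wnRow m < wnCol m := by
  have h2 := positionNumber_upper h' (wnCol m').2
  have h3 := triangular_add_le (show (wnRow m' : ℕ) < wnCol m' from h')
  have h4 := add_one_eq_positionNumber m
  have h5 := add_one_eq_positionNumber m'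
  have : (m : ℕ) < m' := hm
  have : (wnRow m' : ℕ) < wnCol m' := h'
  rcases lt_trichotomy (wnRow m) (wnCol m) with h | h | h
  · exact h
  · rw [h, positionNumber_diag] at h4
    omega
  · have h1 := positionNumber_lower h (wnRow m).2
    have := (wnRow m).2
    have := (wnCol m).2
    have : (wnCol m : ℕ) < wnRow m := h
    omega

/-- The basis elements below the diagonal come last. -/
theorem le_of_lt_diag {m m' : WNIndex N} (h' : wnRow m' = wnCol m') (hm : m < m') :
    wnRow m ≤ wnCol m := by
  have h4 := add_one_eq_positionNumber m
  have h5 := add_one_eq_positionNumber m'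
  rw [h', positionNumber_diag] at h5
  have : (m : ℕ) < m' := hm
  have h0 := wnPosition_not_last m'
  rw [h'] at h0
  by_contra! h
  have h1 := positionNumber_lower h (wnRow m).2
  have h2 := triangular_add_le (show (wnCol m : ℕ) < wnRow m from h)
  have := (wnCol m').2
  omega

theorem mem_upperBlock {k : ℕ} (hk : k ∈ Finset.Ico 1 N) {m : WNIndex N} :
    m ∈ upperBlock N k ↔ wnRow m < wnCol m ∧ (wnCol m : ℕ) + k = N := by
  obtain ⟨hk1, hkN⟩ := Finset.mem_Ico.1 hk
  obtain ⟨q, rfl⟩ := Nat.exists_eq_add_of_lt hkN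
  -- the first number of the block is that of the top entry of column `q + 1`
  have e : (k + q + 1) * (k - 1) - k * (k - 1) / 2 + triangular (q + 1) =
      triangular (k + q) := by
    obtain ⟨j, rfl⟩ := Nat.exists_eq_add_of_le' hk1
    have h1 := two_mul_triangular j
    have h2 := two_mul_triangular (q + 1)
    have h3 := two_mul_triangular (j + 1 + q)
    have h4 : (j + 1) * (j + 1 - 1) / 2 = triangular j := by
      rw [triangular, Nat.add_sub_cancel, mul_comm]
    rw [h4, Nat.add_sub_cancel]
    have h5 : triangular j ≤ (j + 1 + q + 1) * j := by nlinarith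
    zify [h5] at h1 h2 h3 ⊢
    nlinarith
  simp only [upperBlock, Finset.mem_filter, Finset.mem_univ, true_and, Finset.mem_Icc]
  constructor
  · rintro ⟨h1, h2⟩
    obtain ⟨p, hp⟩ := Nat.exists_eq_add_of_le h1
    have h3 : positionNumber (k + q + 1) p (q + 1) + triangular (q + 1) =
      triangular (k + q) + p + 1 := positionNumber_upper (by omega) (by omega)
    have := position_of_number (m := m) (p := ⟨p, by omega⟩) (q := ⟨q + 1, by omega⟩)
      (by simp only; omega) (by simp only; omega)
    rw [this.1, this.2]
    refine ⟨Fin.mk_lt_mk.2 (by omega), ?_⟩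
    simp only
    omega
  · rintro ⟨h1, h2⟩
    have h1' : (wnRow m : ℕ) < wnCol m := h1
    have h3 := positionNumber_upper h1' (wnCol m).2
    rw [← add_one_eq_positionNumber, show (wnCol m : ℕ) = q + 1 by omega,
      Nat.add_sub_cancel] at h3
    omega

theorem mem_lowerBlock {k : ℕ} (hk : k ∈ Finset.Ico 1 N) {m : WNIndex N} :
    m ∈ lowerBlock N k ↔ wnCol m < wnRow m ∧ (wnRow m : ℕ) + k = N := by
  obtain ⟨hk1, hkN⟩ := Finset.mem_Ico.1 hk
  obtain ⟨q, rfl⟩ := Nat.exists_eq_add_of_lt hkN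
  -- the last number of the block is that of the leftmost entry of row `q + 1`
  have e : (k + q + 1) * (k + q + 1 - k) + k * (k + 1) / 2 =
      triangular (k + q) + (k + q + 1) + triangular q := by
    have h1 := two_mul_triangular k
    have h2 := two_mul_triangular q
    have h3 := two_mul_triangular (k + q)
    rw [show k + q + 1 - k = q + 1 by omega, show k * (k + 1) / 2 = triangular k from rfl]
    nlinarith
  have e2 := triangular_succ q
  simp only [lowerBlock, Finset.mem_filter, Finset.mem_univ, true_and, Finset.mem_Icc]
  constructor
  · rintro ⟨h1, h2⟩
    rw [e] at h1 h2
    obtain ⟨p, hp⟩ := Nat.exists_eq_add_of_le h2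
    have h3 : positionNumber (k + q + 1) (q + 1) p + p + 1 =
      triangular (k + q) + (k + q + 1) + triangular (q + 1) :=
        positionNumber_lower (by omega) (by omega)
    have := position_of_number (m := m) (p := ⟨q + 1, by omega⟩) (q := ⟨p, by omega⟩)
      (by simp only; omega) (by simp only; omega)
    rw [this.1, this.2]
    refine ⟨Fin.mk_lt_mk.2 (by omega), ?_⟩
    simp only
    omega
  · rintro ⟨h1, h2⟩
    have h1' : (wnCol m : ℕ) < wnRow m := h1
    have h3 := positionNumber_lower h1' (wnRow m).2
    rw [← add_one_eq_positionNumber, show (wnRow m : ℕ) = q + 1 by omega,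
      Nat.add_sub_cancel] at h3
    rw [e]
    omega

theorem mem_cartanBlock {m : WNIndex N} : m ∈ cartanBlock N ↔ wnRow m = wnCol m := by
  have hN : 0 < N := (wnRow m).pos
  have h2 := sq_eq_two_mul_triangular hN
  simp only [cartanBlock, Finset.mem_filter, Finset.mem_univ, true_and, Finset.mem_Icc,
    cartanNumber_eq]
  constructor
  · rintro ⟨h1, h2⟩
    obtain ⟨p, hp⟩ := Nat.exists_eq_add_of_le h1
    have h3 := positionNumber_diag N p
    have := position_of_number (m := m) (p := ⟨p, by omega⟩) (q := ⟨p, by omega⟩)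
      (by simp only; omega) (by simp only; omega)
    rw [this.1, this.2]
  · intro h
    have h3 := add_one_eq_positionNumber m
    have h4 := wnPosition_not_last m
    rw [h, positionNumber_diag] at h3
    rw [h] at h4
    have := (wnCol m).2
    omega

theorem mem_upperBefore {k : ℕ} (hk : k ≤ N) {m : WNIndex N} :
    m ∈ upperBefore N k ↔ wnRow m < wnCol m ∧ N < (wnCol m : ℕ) + k := by
  simp only [upperBefore, Finset.mem_biUnion]
  constructor
  · rintro ⟨j, hj, hm⟩
    obtain ⟨hj1, hj2⟩ := Finset.mem_Ico.1 hj
    rw [mem_upperBlock (Finset.mem_Ico.2 ⟨hj1, by omega⟩)] at hm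
    exact ⟨hm.1, by omega⟩
  · rintro ⟨h1, h2⟩
    have h1' : (wnRow m : ℕ) < wnCol m := h1
    have := (wnCol m).2
    refine ⟨N - wnCol m, Finset.mem_Ico.2 ⟨by omega, by omega⟩, ?_⟩
    rw [mem_upperBlock (Finset.mem_Ico.2 ⟨by omega, by omega⟩)]
    exact ⟨h1, by omega⟩

theorem mem_upperBefore_self {m : WNIndex N} : m ∈ upperBefore N N ↔ wnRow m < wnCol m := by
  rw [mem_upperBefore le_rfl]
  refine ⟨fun h => h.1, fun h => ⟨h, ?_⟩⟩
  have : (wnRow m : ℕ) < wnCol m := h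
  omega

end Position

/-! ### The derivative of a product of exponentials -/

/-! The facts of calculus below are stated for the entrywise topology on matrices, which carry no
norm by default; a norm inducing it is used in the proofs only. -/

section Exponential

open scoped Matrix.Norms.Operator

variable {ι κ : Type*} [Fintype ι] [Fintype κ]

theorem hasDerivAt_matrix_exp_smul [DecidableEq ι] (A : Matrix ι ι ℂ) {f : ℝ → ℂ} {f' : ℂ} {t : ℝ}
    (hf : HasDerivAt f f' t) :
    HasDerivAt (fun s => NormedSpace.exp (f s • A)) (f' • (A * NormedSpace.exp (f t • A))) t :=
  (hasDerivAt_exp_smul_const' (𝕂 := ℂ) A (f t)).scomp t hf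

theorem HasDerivAt.matrix_mul {f g : ℝ → Matrix ι ι ℂ} {f' g' : Matrix ι ι ℂ} {t : ℝ}
    (hf : HasDerivAt f f' t) (hg : HasDerivAt g g' t) :
    HasDerivAt (fun s => f s * g s) (f' * g t + f t * g') t := by
  classical
  exact HasDerivAt.mul hf hg

/-- `exp (c A) Y exp (-c A) = exp (c ad A) Y`, for a linear map `φ` to matrices under which `T`
corresponds to the commutator with `A`. -/
theorem map_exp_mulVec_mul_exp [DecidableEq ι] [DecidableEq κ]
    (φ : (κ → ℂ) →ₗ[ℂ] Matrix ι ι ℂ) (T : Matrix κ κ ℂ) (A : Matrix ι ι ℂ)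
    (hT : ∀ y, φ (T.mulVec y) = A * φ y - φ y * A) (c : ℂ) (y : κ → ℂ) :
    φ ((NormedSpace.exp (c • T)).mulVec y) * NormedSpace.exp (c • A) =
      NormedSpace.exp (c • A) * φ y := by
  -- `exp (-s A) φ(exp (s T) y) exp (s A)` does not depend on `s`
  set ψ : Matrix κ κ ℂ →ₗ[ℂ] Matrix ι ι ℂ :=
    φ ∘ₗ (LinearMap.applyₗ y) ∘ₗ (Matrix.mulVecBilin ℂ ℂ) with hψ
  have hψa : ∀ B, ψ B = φ (B.mulVec y) := fun B => rfl
  have hd : ∀ s : ℂ, HasDerivAt (fun s : ℂ => NormedSpace.exp (s • -A) *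
      (ψ (NormedSpace.exp (s • T)) * NormedSpace.exp (s • A))) 0 s := by
    intro s
    have h1 := hasDerivAt_exp_smul_const (𝕂 := ℂ) (-A) s
    have h2 := hasDerivAt_exp_smul_const' (𝕂 := ℂ) A s
    have h3 := (LinearMap.toContinuousLinearMap ψ).hasFDerivAt.comp_hasDerivAt s
      (hasDerivAt_exp_smul_const' (𝕂 := ℂ) T s)
    have h4 : ψ (T * NormedSpace.exp (s • T)) =
        A * ψ (NormedSpace.exp (s • T)) - ψ (NormedSpace.exp (s • T)) * A := by
      rw [hψa, hψa, ← Matrix.mulVec_mulVec, hT]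
    refine HasDerivAt.congr_deriv (h1.mul (h3.mul h2)) ?_
    change NormedSpace.exp (s • -A) * -A *
        (ψ (NormedSpace.exp (s • T)) * NormedSpace.exp (s • A)) +
      NormedSpace.exp (s • -A) * (ψ (T * NormedSpace.exp (s • T)) * NormedSpace.exp (s • A) +
        ψ (NormedSpace.exp (s • T)) * (A * NormedSpace.exp (s • A))) = 0
    rw [h4]
    noncomm_ring
  have hc := is_const_of_deriv_eq_zero (fun s => (hd s).differentiableAt)
    (fun s => (hd s).deriv) c 0
  simp only [zero_smul, NormedSpace.exp_zero, one_mul, mul_one, hψa, Matrix.one_mulVec] at hc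
  have hinv : NormedSpace.exp (c • A) * NormedSpace.exp (-(c • A)) = 1 := by
    rw [← Matrix.exp_add_of_commute _ _ (Commute.neg_right (Commute.refl (c • A))), add_neg_cancel,
      NormedSpace.exp_zero]
  rw [← hc, ← mul_assoc, smul_neg, hinv, one_mul]

theorem HasDerivAt.matrix_unique {f : ℝ → Matrix ι ι ℂ} {f' g' : Matrix ι ι ℂ} {t : ℝ}
    (hf : HasDerivAt f f' t) (hg : HasDerivAt f g' t) : f' = g' :=
  HasDerivAt.unique hf hg

theorem hasDerivAt_matrix_const (A : Matrix ι ι ℂ) (t : ℝ) :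
    HasDerivAt (fun _ : ℝ => A) 0 t :=
  hasDerivAt_const t A

theorem HasDerivAt.linearMap_matrix {E : Type*} [NormedAddCommGroup E] [NormedSpace ℂ E]
    [FiniteDimensional ℂ E] (φ : E →ₗ[ℂ] Matrix ι ι ℂ) {f : ℝ → E} {f' : E} {t : ℝ}
    (hf : HasDerivAt f f' t) : HasDerivAt (fun s => φ (f s)) (φ f') t := by
  classical
  exact ((LinearMap.toContinuousLinearMap φ).restrictScalars ℝ).hasFDerivAt.comp_hasDerivAt t hf

theorem HasDerivAt.matrix_const_add (A : Matrix ι ι ℂ) {f : ℝ → Matrix ι ι ℂ}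
    {f' : Matrix ι ι ℂ} {t : ℝ} (hf : HasDerivAt f f' t) :
    HasDerivAt (fun s => A + f s) f' t :=
  HasDerivAt.const_add A hf

/-- Where an affine function takes invertible values, the entries of its inverse are entire. -/
theorem differentiable_matrix_inv {E : Type*} [NormedAddCommGroup E] [NormedSpace ℂ E]
    [DecidableEq ι] (φ : E →L[ℂ] Matrix ι ι ℂ) (A : Matrix ι ι ℂ) (h : ∀ x, IsUnit (A + φ x))
    (i j : ι) : Differentiable ℂ fun x => (A + φ x)⁻¹ i j := by
  have h1 : Differentiable ℂ fun x => (A + φ x)⁻¹ := by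
    intro x
    simp only [Matrix.nonsing_inv_eq_ringInverse]
    exact (differentiableAt_inverse (h x)).comp x (φ.differentiable.const_add A).differentiableAt
  exact (LinearMap.toContinuousLinearMap (Matrix.entryLinearMap ℂ ℂ i j)).differentiable.comp h1

end Exponential

section Derivative

attribute [local instance] LieRing.ofAssociativeRing

variable {N : ℕ} (X : Module.Basis (WNIndex N) ℂ (SLC N))

/-- The product of the first `m` exponentials. -/
noncomputable def wnPrefix (u : WNIndex N → ℂ) (m : ℕ) : Matrix (Fin N) (Fin N) ℂ :=
  (((List.finRange (N ^ 2 - 1)).take m).map fun k =>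
    NormedSpace.exp (u k • (X k : Matrix (Fin N) (Fin N) ℂ))).prod

theorem wnPrefix_zero (u : WNIndex N → ℂ) : wnPrefix X u 0 = 1 := by
  simp [wnPrefix]

theorem wnPrefix_succ (u : WNIndex N → ℂ) (m : WNIndex N) :
    wnPrefix X u (m + 1) =
      wnPrefix X u m * NormedSpace.exp (u m • (X m : Matrix (Fin N) (Fin N) ℂ)) := by
  rw [wnPrefix, List.take_add_one, List.map_append, List.prod_append, wnPrefix]
  simp

theorem wnPrefix_all (u : WNIndex N → ℂ) : wnPrefix X u (N ^ 2 - 1) = wnProduct X u := by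
  rw [wnPrefix, List.take_of_length_le (by simp), wnProduct]

theorem isUnit_wnProduct (u : WNIndex N → ℂ) : IsUnit (wnProduct X u) := by
  rw [wnProduct]
  generalize List.finRange (N ^ 2 - 1) = l
  induction l with
  | nil => simp
  | cons m l ih =>
    rw [List.map_cons, List.prod_cons]
    exact (Matrix.isUnit_exp _).mul ih

/-- The linear map `a ↦ ∑ a_k X_k`. -/
noncomputable def wnGeneratorₗ : (WNIndex N → ℂ) →ₗ[ℂ] Matrix (Fin N) (Fin N) ℂ :=
  (LieAlgebra.SpecialLinear.sl (Fin N) ℂ).toSubmodule.subtype ∘ₗ X.equivFun.symm.toLinearMap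

theorem wnGeneratorₗ_apply (a : WNIndex N → ℂ) : wnGeneratorₗ X a = wnGenerator X a := by
  simp [wnGeneratorₗ, wnGenerator, Module.Basis.equivFun_symm_apply]

theorem wnGenerator_injective : Function.Injective (wnGenerator X) := by
  intro a b h
  rw [← wnGeneratorₗ_apply, ← wnGeneratorₗ_apply] at h
  exact X.equivFun.symm.injective (Subtype.ext h)

theorem wnGenerator_single (m : WNIndex N) : wnGenerator X (Pi.single m 1) = X m := by
  simp [wnGenerator, Pi.single_apply]

theorem wnGeneratorₗ_ad (m : WNIndex N) (y : WNIndex N → ℂ) :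
    wnGeneratorₗ X ((LinearMap.toMatrix X X (LieAlgebra.ad ℂ (SLC N) (X m))).mulVec y) =
      X m * wnGeneratorₗ X y - wnGeneratorₗ X y * X m := by
  have h : X.equivFun.symm ((LinearMap.toMatrix X X (LieAlgebra.ad ℂ (SLC N) (X m))).mulVec y) =
      ⁅X m, X.equivFun.symm y⁆ := by
    rw [← LieAlgebra.ad_apply ℂ, LinearEquiv.symm_apply_eq]
    have := LinearMap.toMatrix_mulVec_repr X X (LieAlgebra.ad ℂ (SLC N) (X m))
      (X.equivFun.symm y)
    rw [Module.Basis.equivFun_apply, ← this, ← Module.Basis.equivFun_apply,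
      LinearEquiv.apply_symm_apply]
  simp only [wnGeneratorₗ, LinearMap.comp_apply, LinearEquiv.coe_coe] at h ⊢
  rw [h]
  exact LieAlgebra.SpecialLinear.sl_bracket (Fin N) ℂ _ _

/-- The first factors of `K` act on `sl(N, ℂ)` by conjugation, and the matrix of this action is the
partial product of the Wei–Norman matrix. -/
theorem wnGeneratorₗ_partialProduct (u y : WNIndex N → ℂ) (l : WNIndex N) :
    wnGeneratorₗ X ((wnPartialProduct X u l).mulVec y) * wnPrefix X u l =
      wnPrefix X u l * wnGeneratorₗ X y := by
  rw [wnPartialProduct, wnPrefix]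
  generalize (List.finRange (N ^ 2 - 1)).take l = ls
  induction ls with
  | nil => simp
  | cons m ls ih =>
    simp only [List.map_cons, List.prod_cons]
    rw [← Matrix.mulVec_mulVec, ← mul_assoc,
      map_exp_mulVec_mul_exp _ _ _ (wnGeneratorₗ_ad X m), mul_assoc, ih, mul_assoc]

/-- The derivative of the product of the first `m` exponentials: each factor contributes its
generator, conjugated by the factors before it. -/
theorem hasDerivAt_wnPrefix {u : ℝ → WNIndex N → ℂ} {v : WNIndex N → ℂ} {t : ℝ}
    (hu : HasDerivAt u v t) (m : ℕ) (hm : m ≤ N ^ 2 - 1) :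
    HasDerivAt (fun s => wnPrefix X (u s) m)
      (wnGeneratorₗ X (∑ l ∈ Finset.univ.filter (fun l : WNIndex N => (l : ℕ) < m),
        v l • (wnMatrix X (u t)).col l) * wnPrefix X (u t) m) t := by
  induction m with
  | zero =>
    simpa [wnPrefix_zero] using hasDerivAt_matrix_const (1 : Matrix (Fin N) (Fin N) ℂ) t
  | succ m ih =>
    obtain ⟨i, rfl⟩ : ∃ i : WNIndex N, (i : ℕ) = m := ⟨⟨m, hm⟩, rfl⟩
    have h1 := (ih (by omega)).matrix_mul
      (hasDerivAt_matrix_exp_smul (X i : Matrix (Fin N) (Fin N) ℂ) (hasDerivAt_pi.1 hu i))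
    simp only [wnPrefix_succ]
    convert h1 using 1
    have hs : (Finset.univ.filter fun l : WNIndex N => (l : ℕ) < i + 1) =
        insert i (Finset.univ.filter fun l : WNIndex N => (l : ℕ) < i) := by
      ext l
      simp only [Finset.mem_filter, Finset.mem_univ, true_and, Finset.mem_insert, Fin.ext_iff]
      omega
    have hcol : (wnMatrix X (u t)).col i =
        (wnPartialProduct X (u t) i).mulVec (Pi.single i 1) := by
      ext j
      simp [wnMatrix, Matrix.col]
    have hk := wnGeneratorₗ_partialProduct X (u t) (Pi.single i 1) i
    rw [wnGeneratorₗ_apply X (Pi.single i 1), wnGenerator_single, ← hcol] at hk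
    rw [hs, Finset.sum_insert (by simp), map_add, map_smul, add_mul, add_comm, ← mul_assoc,
      smul_mul_assoc, ← mul_assoc (wnGeneratorₗ X ((wnMatrix X (u t)).col i)), hk,
      mul_assoc (wnPrefix X (u t) i), mul_smul_comm]

/-- Along every curve `K' = M(A u') K`. -/
theorem hasDerivAt_wnProduct {u : ℝ → WNIndex N → ℂ} {v : WNIndex N → ℂ} {t : ℝ}
    (hu : HasDerivAt u v t) :
    HasDerivAt (fun s => wnProduct X (u s))
      (wnGenerator X ((wnMatrix X (u t)).mulVec v) * wnProduct X (u t)) t := by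
  have h := hasDerivAt_wnPrefix X hu (N ^ 2 - 1) le_rfl
  simp only [wnPrefix_all, wnGeneratorₗ_apply] at h
  convert h using 3
  ext j
  simp [Matrix.mulVec, dotProduct, Matrix.col, mul_comm]

theorem hasDerivAt_wnProduct_iff {u : ℝ → WNIndex N → ℂ} {v : WNIndex N → ℂ} {t : ℝ}
    (hu : HasDerivAt u v t) (a : WNIndex N → ℂ) :
    HasDerivAt (fun s => wnProduct X (u s)) (wnGenerator X a * wnProduct X (u t)) t ↔
      (wnMatrix X (u t)).mulVec v = a := by
  have h := hasDerivAt_wnProduct X hu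
  constructor
  · intro h'
    have := (isUnit_wnProduct X (u t)).mul_left_injective (h.matrix_unique h')
    exact wnGenerator_injective X this
  · rintro rfl
    exact h

theorem wnProduct_zero : wnProduct X 0 = 1 := by
  simp [wnProduct]

end Derivative

/-! ### The factorization into triangular matrices -/

section Triangular

variable {N : ℕ}

/-- The diagonal of the Cartan generator `S_{pp} - S_{p+1,p+1}`. -/
def cartanVector (p : Fin N) (i : Fin N) : ℂ :=
  (if i = p then 1 else 0) - (if (i : ℕ) = p + 1 then 1 else 0)

/-- The part of `∑ u_k X_k` above the diagonal. -/
noncomputable def upperPart : (WNIndex N → ℂ) →ₗ[ℂ] Matrix (Fin N) (Fin N) ℂ :=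
  Fintype.linearCombination ℂ fun m =>
    if wnRow m < wnCol m then Matrix.single (wnRow m) (wnCol m) 1 else 0

/-- The diagonal of `∑ u_k X_k`. -/
noncomputable def diagPart : (WNIndex N → ℂ) →ₗ[ℂ] Fin N → ℂ :=
  Fintype.linearCombination ℂ fun m => if wnRow m = wnCol m then cartanVector (wnRow m) else 0

/-- The part of `∑ u_k X_k` below the diagonal. -/
noncomputable def lowerPart : (WNIndex N → ℂ) →ₗ[ℂ] Matrix (Fin N) (Fin N) ℂ :=
  Fintype.linearCombination ℂ fun m =>
    if wnCol m < wnRow m then Matrix.single (wnRow m) (wnCol m) 1 else 0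

theorem upperPart_eq_zero (u : WNIndex N → ℂ) {p q : Fin N} (h : q ≤ p) :
    upperPart u p q = 0 := by
  rw [upperPart, Fintype.linearCombination_apply, Matrix.sum_apply]
  refine Finset.sum_eq_zero fun m _ => ?_
  split_ifs with hm
  · rw [Matrix.smul_apply, Matrix.single_apply_of_ne _ _ _ _ _ ?_, smul_zero]
    rintro ⟨rfl, rfl⟩
    exact h.not_gt hm
  · simp

theorem lowerPart_eq_zero (u : WNIndex N → ℂ) {p q : Fin N} (h : p ≤ q) :
    lowerPart u p q = 0 := by
  rw [lowerPart, Fintype.linearCombination_apply, Matrix.sum_apply]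
  refine Finset.sum_eq_zero fun m _ => ?_
  split_ifs with hm
  · rw [Matrix.smul_apply, Matrix.single_apply_of_ne _ _ _ _ _ ?_, smul_zero]
    rintro ⟨rfl, rfl⟩
    exact h.not_gt hm
  · simp

theorem upperPart_apply (u : WNIndex N → ℂ) {m : WNIndex N} (h : wnRow m < wnCol m) :
    upperPart u (wnRow m) (wnCol m) = u m := by
  rw [upperPart, Fintype.linearCombination_apply, Matrix.sum_apply,
    Finset.sum_eq_single_of_mem m (Finset.mem_univ m)]
  · simp [h]
  · intro l _ hl
    split_ifs with hm
    · rw [Matrix.smul_apply, Matrix.single_apply_of_ne _ _ _ _ _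
        (fun h' => hl (position_ext h'.1 h'.2)), smul_zero]
    · simp

theorem lowerPart_apply (u : WNIndex N → ℂ) {m : WNIndex N} (h : wnCol m < wnRow m) :
    lowerPart u (wnRow m) (wnCol m) = u m := by
  rw [lowerPart, Fintype.linearCombination_apply, Matrix.sum_apply,
    Finset.sum_eq_single_of_mem m (Finset.mem_univ m)]
  · simp [h]
  · intro l _ hl
    split_ifs with hm
    · rw [Matrix.smul_apply, Matrix.single_apply_of_ne _ _ _ _ _
        (fun h' => hl (position_ext h'.1 h'.2)), smul_zero]
    · simp

/-- The first partial sums of the diagonal of `S_{pp} - S_{p+1,p+1}` vanish except for the one at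
`p`. -/
theorem sum_cartanVector {p : Fin N} (hp : (p : ℕ) + 1 ≠ N) (l : Fin N) :
    ∑ i ∈ Finset.Iic l, cartanVector p i = if l = p then 1 else 0 := by
  have h2 : ∀ i : Fin N, ((i : ℕ) = p + 1 ↔ i = ⟨p + 1, by omega⟩) := fun i => by
    simp [Fin.ext_iff]
  simp only [cartanVector, Finset.sum_sub_distrib, h2, Finset.sum_ite_eq', Finset.mem_Iic]
  simp only [Fin.le_def, Fin.ext_iff]
  split_ifs <;> first | omega | simp

theorem sum_cartanVector_eq_zero {p : Fin N} (hp : (p : ℕ) + 1 ≠ N) :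
    ∑ i, cartanVector p i = 0 := by
  have h2 : ∀ i : Fin N, ((i : ℕ) = p + 1 ↔ i = ⟨p + 1, by omega⟩) := fun i => by
    simp [Fin.ext_iff]
  simp [cartanVector, Finset.sum_sub_distrib, h2]

theorem row_add_one_ne_of_diag {m : WNIndex N} (h : wnRow m = wnCol m) :
    (wnRow m : ℕ) + 1 ≠ N := fun h' =>
  wnPosition_not_last m ⟨h', by rw [← h]; exact h'⟩

theorem sum_diagPart_eq_zero (u : WNIndex N → ℂ) : ∑ i, diagPart u i = 0 := by
  simp only [diagPart, Fintype.linearCombination_apply, Finset.sum_apply, Pi.smul_apply,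
    smul_eq_mul]
  rw [Finset.sum_comm]
  refine Finset.sum_eq_zero fun m _ => ?_
  split_ifs with h
  · rw [← Finset.mul_sum, sum_cartanVector_eq_zero (row_add_one_ne_of_diag h), mul_zero]
  · simp

theorem sum_diagPart_Iic (u : WNIndex N → ℂ) {m : WNIndex N} (h : wnRow m = wnCol m) :
    ∑ i ∈ Finset.Iic (wnRow m), diagPart u i = u m := by
  simp only [diagPart, Fintype.linearCombination_apply, Finset.sum_apply, Pi.smul_apply,
    smul_eq_mul]
  rw [Finset.sum_comm, Finset.sum_eq_single_of_mem m (Finset.mem_univ m)]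
  · simp only [h, if_true, ← Finset.mul_sum]
    rw [← h, sum_cartanVector (row_add_one_ne_of_diag h), if_pos rfl, mul_one]
  · intro l _ hl
    split_ifs with hm
    · rw [← Finset.mul_sum, sum_cartanVector (row_add_one_ne_of_diag hm), if_neg, mul_zero]
      exact fun h' => hl (position_ext h'.symm (by rw [← hm, ← h, h']))
    · simp

/-- A vector with vanishing sum is the diagonal of the combination of Cartan generators whose
coefficients are its first partial sums. -/
theorem diagPart_eq_iff (u : WNIndex N → ℂ) {d : Fin N → ℂ} (hd : ∑ i, d i = 0) :
    diagPart u = d ↔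
      ∀ m : WNIndex N, wnRow m = wnCol m → u m = ∑ i ∈ Finset.Iic (wnRow m), d i := by
  constructor
  · rintro rfl m hm
    rw [sum_diagPart_Iic u hm]
  · intro h
    have key : ∀ l : Fin N, ∑ i ∈ Finset.Iic l, diagPart u i = ∑ i ∈ Finset.Iic l, d i := by
      intro l
      by_cases hl : (l : ℕ) + 1 = N
      · have : Finset.Iic l = Finset.univ := by
          ext i
          simp only [Finset.mem_Iic, Finset.mem_univ, iff_true, Fin.le_def]
          omega
        rw [this, sum_diagPart_eq_zero, hd]
      · obtain ⟨m, h1, h2⟩ := exists_position (p := l) (q := l) (by tauto)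
        subst h1
        rw [sum_diagPart_Iic u h2.symm, h m h2.symm]
    have key2 : ∀ l : Fin N, ∑ i ∈ Finset.Iio l, diagPart u i = ∑ i ∈ Finset.Iio l, d i := by
      intro l
      by_cases hl : (l : ℕ) = 0
      · have : Finset.Iio l = ∅ := by
          ext i
          simp only [Finset.mem_Iio, Fin.lt_def, Finset.notMem_empty, iff_false]
          omega
        rw [this, Finset.sum_empty, Finset.sum_empty]
      · have : Finset.Iio l = Finset.Iic ⟨l - 1, by omega⟩ := by
          ext i
          simp only [Finset.mem_Iio, Finset.mem_Iic, Fin.lt_def, Fin.le_def]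
          omega
        rw [this, key]
    ext l
    have h1 := key l
    rw [← Finset.Iio_insert, Finset.sum_insert (by simp), Finset.sum_insert (by simp),
      key2] at h1
    exact add_right_cancel h1

/-- The unipotent upper triangular factor of `K`. -/
noncomputable def upperFactor (u : WNIndex N → ℂ) : Matrix (Fin N) (Fin N) ℂ := 1 + upperPart u

/-- The diagonal factor of `K`. -/
noncomputable def diagFactor (u : WNIndex N → ℂ) : Matrix (Fin N) (Fin N) ℂ :=
  Matrix.diagonal fun i => Complex.exp (diagPart u i)

/-- The unipotent lower triangular factor of `K`. -/
noncomputable def lowerFactor (u : WNIndex N → ℂ) : Matrix (Fin N) (Fin N) ℂ := 1 + lowerPart u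

/-- `∑ a_k X_k`, written by positions and hence without reference to a basis. -/
noncomputable def generatorMatrix : (WNIndex N → ℂ) →ₗ[ℂ] Matrix (Fin N) (Fin N) ℂ :=
  upperPart + Matrix.diagonalLinearMap (Fin N) ℂ ℂ ∘ₗ diagPart + lowerPart

theorem generatorMatrix_eq (a : WNIndex N → ℂ) :
    generatorMatrix a = upperPart a + Matrix.diagonal (diagPart a) + lowerPart a := rfl

/-- The basis elements, as matrices. -/
noncomputable def wnElement (m : WNIndex N) : Matrix (Fin N) (Fin N) ℂ :=
  generatorMatrix (Pi.single m 1)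

theorem upperPart_single (m : WNIndex N) (c : ℂ) : upperPart (Pi.single m c) =
    if wnRow m < wnCol m then c • Matrix.single (wnRow m) (wnCol m) 1 else 0 := by
  rw [upperPart, Fintype.linearCombination_apply_single]
  split_ifs <;> simp

theorem lowerPart_single (m : WNIndex N) (c : ℂ) : lowerPart (Pi.single m c) =
    if wnCol m < wnRow m then c • Matrix.single (wnRow m) (wnCol m) 1 else 0 := by
  rw [lowerPart, Fintype.linearCombination_apply_single]
  split_ifs <;> simp

theorem diagPart_single (m : WNIndex N) (c : ℂ) : diagPart (Pi.single m c) =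
    if wnRow m = wnCol m then c • cartanVector (wnRow m) else 0 := by
  rw [diagPart, Fintype.linearCombination_apply_single]
  split_ifs <;> simp

theorem wnElement_upper {m : WNIndex N} (h : wnRow m < wnCol m) :
    wnElement m = Matrix.single (wnRow m) (wnCol m) 1 := by
  simp [wnElement, generatorMatrix_eq, upperPart_single, lowerPart_single, diagPart_single, h,
    h.ne, h.not_gt]

theorem wnElement_lower {m : WNIndex N} (h : wnCol m < wnRow m) :
    wnElement m = Matrix.single (wnRow m) (wnCol m) 1 := by
  simp [wnElement, generatorMatrix_eq, upperPart_single, lowerPart_single, diagPart_single, h,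
    h.ne', h.not_gt]

theorem wnElement_diag {m : WNIndex N} (h : wnRow m = wnCol m) :
    wnElement m = Matrix.diagonal (cartanVector (wnRow m)) := by
  simp [wnElement, generatorMatrix_eq, upperPart_single, lowerPart_single, diagPart_single, h]

theorem sum_smul_wnElement (a : WNIndex N → ℂ) : ∑ m, a m • wnElement m = generatorMatrix a := by
  simp only [wnElement, ← map_smul, ← map_sum]
  congr 1
  ext j
  simp [Finset.sum_apply, Pi.single_apply]

theorem exp_smul_of_sq_eq_zero {A : Matrix (Fin N) (Fin N) ℂ} (hA : A * A = 0) (c : ℂ) :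
    NormedSpace.exp (c • A) = 1 + c • A := by
  rw [NormedSpace.exp_eq_tsum ℂ]
  simp only
  rw [tsum_eq_sum (s := Finset.range 2)]
  · simp [Finset.sum_range_succ]
  · intro k hk
    obtain ⟨j, rfl⟩ := Nat.exists_eq_add_of_le (not_lt.1 (mt Finset.mem_range.2 hk))
    simp [pow_add, sq, hA]

theorem exp_smul_diagonal (d : Fin N → ℂ) (c : ℂ) :
    NormedSpace.exp (c • Matrix.diagonal d) = Matrix.diagonal fun i => Complex.exp (c * d i) := by
  rw [← Matrix.diagonal_smul, Matrix.exp_diagonal]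
  congr 1
  ext i
  rw [Pi.coe_exp, Complex.exp_eq_exp_ℂ]
  rfl

theorem lowerPart_eq_zero_of_forall {u : WNIndex N → ℂ}
    (h : ∀ m, wnCol m < wnRow m → u m = 0) : lowerPart u = 0 := by
  rw [lowerPart, Fintype.linearCombination_apply]
  refine Finset.sum_eq_zero fun m _ => ?_
  split_ifs with hm
  · rw [h m hm, zero_smul]
  · simp

theorem diagPart_eq_zero_of_forall {u : WNIndex N → ℂ}
    (h : ∀ m, wnRow m = wnCol m → u m = 0) : diagPart u = 0 := by
  rw [diagPart, Fintype.linearCombination_apply]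
  refine Finset.sum_eq_zero fun m _ => ?_
  split_ifs with hm
  · rw [h m hm, zero_smul]
  · simp

/-- Multiplying the factorization of the product of the first exponentials by the next one only
changes one entry: the generators are ordered such that those above the diagonal have vanishing
products with the later ones above the diagonal, and likewise below the diagonal. -/
theorem factors_mul_exp {w : WNIndex N → ℂ} {m : WNIndex N} (hw : ∀ l, m ≤ l → w l = 0) (c : ℂ) :
    upperFactor w * diagFactor w * lowerFactor w * NormedSpace.exp (c • wnElement m) =
      upperFactor (w + Pi.single m c) * diagFactor (w + Pi.single m c) *
        lowerFactor (w + Pi.single m c) := by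
  have hlt : ∀ {l}, w l ≠ 0 → l < m := fun {l} h => not_le.1 fun h' => h (hw l h')
  rcases lt_trichotomy (wnRow m) (wnCol m) with h | h | h
  · have hl : lowerPart w = 0 := lowerPart_eq_zero_of_forall fun l hl => by
      by_contra h0
      exact hl.not_gt (upper_of_lt_upper h (hlt h0))
    have hd : diagPart w = 0 := diagPart_eq_zero_of_forall fun l hl => by
      by_contra h0
      exact (upper_of_lt_upper h (hlt h0)).ne hl
    have hu : upperPart w * Matrix.single (wnRow m) (wnCol m) 1 = 0 := by
      rw [upperPart, Fintype.linearCombination_apply, Finset.sum_mul]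
      refine Finset.sum_eq_zero fun l _ => ?_
      by_cases h0 : w l = 0
      · simp [h0]
      · have h1 := upper_of_lt_upper h (hlt h0)
        have h2 := wnCol_le_of_lt h1 h (hlt h0)
        rw [if_pos h1, smul_mul_assoc, Matrix.single_mul_single_of_ne _ _ _ _ (h.trans_le h2).ne',
          smul_zero]
    rw [wnElement_upper h, exp_smul_of_sq_eq_zero (Matrix.single_mul_single_of_ne _ _ _ _ h.ne' _)]
    simp only [upperFactor, diagFactor, lowerFactor, map_add, upperPart_single, diagPart_single,
      lowerPart_single, if_pos h, if_neg h.ne, if_neg h.not_gt, hl, hd]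
    simp only [Matrix.diagonal_one, add_zero, mul_one, Pi.zero_apply, Complex.exp_zero,
      mul_add, add_mul, one_mul, mul_smul_comm, hu]
    abel
  · have hl : lowerPart w = 0 := lowerPart_eq_zero_of_forall fun l hl => by
      by_contra h0
      exact hl.not_ge (le_of_lt_diag h (hlt h0))
    rw [wnElement_diag h, exp_smul_diagonal]
    simp only [upperFactor, diagFactor, lowerFactor, map_add, upperPart_single, diagPart_single,
      lowerPart_single, if_pos h, if_neg h.not_lt, if_neg h.not_gt, hl]
    simp [mul_assoc, Complex.exp_add]
  · have hl : lowerPart w * Matrix.single (wnRow m) (wnCol m) 1 = 0 := by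
      rw [lowerPart, Fintype.linearCombination_apply, Finset.sum_mul]
      refine Finset.sum_eq_zero fun l _ => ?_
      by_cases h0 : w l = 0
      · simp [h0]
      · split_ifs with h1
        · have h2 := wnRow_le_of_lt h1 h (hlt h0)
          rw [smul_mul_assoc, Matrix.single_mul_single_of_ne _ _ _ _ (h1.trans_le h2).ne,
            smul_zero]
        · simp
    rw [wnElement_lower h, exp_smul_of_sq_eq_zero (Matrix.single_mul_single_of_ne _ _ _ _ h.ne _)]
    simp only [upperFactor, diagFactor, lowerFactor, map_add, upperPart_single, diagPart_single,
      lowerPart_single, if_pos h, if_neg h.ne', if_neg h.not_gt, add_zero]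
    rw [mul_assoc]
    congr 1
    simp only [mul_one, mul_add, add_mul, one_mul, mul_smul_comm, hl, add_zero]
    abel

/-- The defining property of the ordered basis, in terms of positions. -/
theorem isWNBasis_iff (X : Module.Basis (WNIndex N) ℂ (SLC N)) :
    IsWNBasis N X ↔ ∀ m, (X m : Matrix (Fin N) (Fin N) ℂ) = wnElement m := by
  have hdiag : ∀ l l' : Fin N, (l' : ℕ) = l + 1 →
      Matrix.diagonal (cartanVector l) = Matrix.single l l (1 : ℂ) - Matrix.single l' l' 1 := by
    intro l l' h
    ext i j
    rcases eq_or_ne i j with rfl | hij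
    · simp [cartanVector, Matrix.single_apply, ← h, Fin.ext_iff, eq_comm]
    · simp only [Matrix.diagonal_apply_ne _ hij, Matrix.sub_apply, Matrix.single_apply]
      rw [if_neg, if_neg, sub_zero] <;> rintro ⟨rfl, rfl⟩ <;> exact hij rfl
  constructor
  · intro hX m
    have hm := add_one_eq_positionNumber m
    rcases lt_trichotomy (wnRow m) (wnCol m) with h | h | h
    · rw [wnElement_upper h]
      refine hX.upper _ _ h m ?_
      rw [hm, positionNumber, if_pos (Fin.lt_def.1 h)]
    · have hN := row_add_one_ne_of_diag h
      rw [wnElement_diag h, hdiag _ ⟨wnRow m + 1, by omega⟩ rfl]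
      refine hX.cartan _ _ rfl m ?_
      rw [hm, ← h, positionNumber, if_neg (lt_irrefl _), if_pos rfl]
    · rw [wnElement_lower h]
      refine hX.lower _ _ h m ?_
      have h' := Fin.lt_def.1 h
      rw [hm, positionNumber, if_neg h'.not_gt, if_neg h'.ne']
  · intro hX
    refine ⟨fun p q hpq m hm => ?_, fun l l' hl m hm => ?_, fun p q hpq m hm => ?_⟩
    · have h' := Fin.lt_def.1 hpq
      obtain ⟨rfl, rfl⟩ := position_of_number (m := m) (p := p) (q := q) (by omega)
        (by rw [hm, positionNumber, if_pos h'])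
      rw [hX, wnElement_upper hpq]
    · obtain ⟨h1, h2⟩ := position_of_number (m := m) (p := l) (q := l) (by omega)
        (by rw [hm, positionNumber, if_neg (lt_irrefl _), if_pos rfl])
      rw [hX, wnElement_diag (h1.trans h2.symm), h1, hdiag _ _ hl]
    · have h' := Fin.lt_def.1 hpq
      obtain ⟨rfl, rfl⟩ := position_of_number (m := m) (p := q) (q := p) (by omega)
        (by rw [hm, positionNumber, if_neg h'.not_gt, if_neg h'.ne'])
      rw [hX, wnElement_lower hpq]

variable {X : Module.Basis (WNIndex N) ℂ (SLC N)}

theorem wnGenerator_eq (hX : IsWNBasis N X) (a : WNIndex N → ℂ) :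
    wnGenerator X a = generatorMatrix a := by
  rw [wnGenerator, ← sum_smul_wnElement]
  exact Finset.sum_congr rfl fun m _ => by rw [(isWNBasis_iff X).1 hX]

theorem wnPrefix_eq (hX : IsWNBasis N X) (u : WNIndex N → ℂ) (m : ℕ) (hm : m ≤ N ^ 2 - 1) :
    wnPrefix X u m = upperFactor (fun l => if (l : ℕ) < m then u l else 0) *
      diagFactor (fun l => if (l : ℕ) < m then u l else 0) *
        lowerFactor (fun l => if (l : ℕ) < m then u l else 0) := by
  induction m with
  | zero =>
    have : (fun l : WNIndex N => if (l : ℕ) < 0 then u l else 0) = 0 := by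
      ext l
      simp
    rw [this]
    simp [wnPrefix_zero, upperFactor, diagFactor, lowerFactor]
  | succ m ih =>
    obtain ⟨i, rfl⟩ : ∃ i : WNIndex N, (i : ℕ) = m := ⟨⟨m, hm⟩, rfl⟩
    have hs : (fun l : WNIndex N => if (l : ℕ) < i + 1 then u l else 0) =
        (fun l : WNIndex N => if (l : ℕ) < i then u l else 0) + Pi.single i (u i) := by
      ext l
      rcases lt_trichotomy l i with h | rfl | h
      · have : (l : ℕ) < i := h
        rw [if_pos (by omega), Pi.add_apply, if_pos this, Pi.single_eq_of_ne h.ne, add_zero]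
      · simp
      · have : (i : ℕ) < l := h
        rw [if_neg (by omega), Pi.add_apply, if_neg (by omega), Pi.single_eq_of_ne h.ne',
          add_zero]
    rw [wnPrefix_succ, ih (by omega), (isWNBasis_iff X).1 hX, factors_mul_exp, hs]
    intro l hl
    exact if_neg (not_lt.2 hl)

/-- The product of exponentials is the product of a unipotent upper triangular, a diagonal, and a
unipotent lower triangular matrix; the unknowns of the upper and lower blocks are the entries of
the unipotent factors. -/
theorem wnProduct_eq (hX : IsWNBasis N X) (u : WNIndex N → ℂ) :
    wnProduct X u = upperFactor u * diagFactor u * lowerFactor u := by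
  rw [← wnPrefix_all, wnPrefix_eq hX u _ le_rfl]
  simp only [Fin.is_lt, if_true]

end Triangular

/-! ### The Wei–Norman system in terms of the triangular factors -/

section Equations

variable {N : ℕ}

theorem upperFactor_apply (u : WNIndex N → ℂ) (p q : Fin N) :
    upperFactor u p q = (1 : Matrix (Fin N) (Fin N) ℂ) p q + upperPart u p q := rfl

theorem lowerFactor_apply (u : WNIndex N → ℂ) (p q : Fin N) :
    lowerFactor u p q = (1 : Matrix (Fin N) (Fin N) ℂ) p q + lowerPart u p q := rfl

theorem upperFactor_eq_zero (u : WNIndex N → ℂ) {p q : Fin N} (h : q < p) :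
    upperFactor u p q = 0 := by
  rw [upperFactor_apply, Matrix.one_apply_ne h.ne', upperPart_eq_zero u h.le, add_zero]

theorem upperFactor_self (u : WNIndex N → ℂ) (p : Fin N) : upperFactor u p p = 1 := by
  rw [upperFactor_apply, Matrix.one_apply_eq, upperPart_eq_zero u le_rfl, add_zero]

theorem lowerFactor_eq_zero (u : WNIndex N → ℂ) {p q : Fin N} (h : p < q) :
    lowerFactor u p q = 0 := by
  rw [lowerFactor_apply, Matrix.one_apply_ne h.ne, lowerPart_eq_zero u h.le, add_zero]

theorem lowerFactor_self (u : WNIndex N → ℂ) (p : Fin N) : lowerFactor u p p = 1 := by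
  rw [lowerFactor_apply, Matrix.one_apply_eq, lowerPart_eq_zero u le_rfl, add_zero]

theorem det_upperFactor (u : WNIndex N → ℂ) : (upperFactor u).det = 1 := by
  rw [Matrix.det_of_isUpperTriangular (M := upperFactor u) fun p q h => upperFactor_eq_zero u h]
  simp [upperFactor_self]

theorem det_lowerFactor (u : WNIndex N → ℂ) : (lowerFactor u).det = 1 := by
  rw [Matrix.det_of_isLowerTriangular _ fun p q h => lowerFactor_eq_zero u h]
  simp [lowerFactor_self]

theorem det_diagFactor (u : WNIndex N → ℂ) : (diagFactor u).det = 1 := by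
  rw [diagFactor, Matrix.det_diagonal, ← Complex.exp_sum, sum_diagPart_eq_zero, Complex.exp_zero]

theorem isUnit_upperFactor (u : WNIndex N → ℂ) : IsUnit (upperFactor u) := by
  rw [Matrix.isUnit_iff_isUnit_det, det_upperFactor]
  exact isUnit_one

theorem isUnit_lowerFactor (u : WNIndex N → ℂ) : IsUnit (lowerFactor u) := by
  rw [Matrix.isUnit_iff_isUnit_det, det_lowerFactor]
  exact isUnit_one

theorem upperFactor_inv_mul (u : WNIndex N → ℂ) : (upperFactor u)⁻¹ * upperFactor u = 1 :=
  Matrix.nonsing_inv_mul _ ((Matrix.isUnit_iff_isUnit_det _).1 (isUnit_upperFactor u))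

theorem upperFactor_mul_inv (u : WNIndex N → ℂ) : upperFactor u * (upperFactor u)⁻¹ = 1 :=
  Matrix.mul_nonsing_inv _ ((Matrix.isUnit_iff_isUnit_det _).1 (isUnit_upperFactor u))

theorem lowerFactor_inv_mul (u : WNIndex N → ℂ) : (lowerFactor u)⁻¹ * lowerFactor u = 1 :=
  Matrix.nonsing_inv_mul _ ((Matrix.isUnit_iff_isUnit_det _).1 (isUnit_lowerFactor u))

theorem lowerFactor_mul_inv (u : WNIndex N → ℂ) : lowerFactor u * (lowerFactor u)⁻¹ = 1 :=
  Matrix.mul_nonsing_inv _ ((Matrix.isUnit_iff_isUnit_det _).1 (isUnit_lowerFactor u))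

theorem upperFactor_inv_eq_zero (u : WNIndex N → ℂ) {p q : Fin N} (h : q < p) :
    (upperFactor u)⁻¹ p q = 0 := by
  let _ := (isUnit_upperFactor u).invertible
  exact Matrix.blockTriangular_inv_of_blockTriangular
    (M := upperFactor u) (b := id) (fun p q h => upperFactor_eq_zero u h) h

theorem lowerFactor_inv_eq_zero (u : WNIndex N → ℂ) {p q : Fin N} (h : p < q) :
    (lowerFactor u)⁻¹ p q = 0 := by
  let _ := (isUnit_lowerFactor u).invertible
  exact Matrix.blockTriangular_inv_of_blockTriangular
    (M := lowerFactor u) (b := OrderDual.toDual) (fun p q h => lowerFactor_eq_zero u h) h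

/-- The inverse of `diagFactor`. -/
noncomputable def diagFactorInv (u : WNIndex N → ℂ) : Matrix (Fin N) (Fin N) ℂ :=
  Matrix.diagonal fun i => Complex.exp (-diagPart u i)

theorem diagFactor_mul_inv (u : WNIndex N → ℂ) : diagFactor u * diagFactorInv u = 1 := by
  simp [diagFactor, diagFactorInv, ← Complex.exp_add]

theorem diagFactorInv_mul (u : WNIndex N → ℂ) : diagFactorInv u * diagFactor u = 1 := by
  simp [diagFactor, diagFactorInv, ← Complex.exp_add]

/-- The derivative of the product of the three factors. -/
theorem hasDerivAt_factors {u : ℝ → WNIndex N → ℂ} {v : WNIndex N → ℂ} {t : ℝ}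
    (hu : HasDerivAt u v t) :
    HasDerivAt (fun s => upperFactor (u s) * diagFactor (u s) * lowerFactor (u s))
      ((upperPart v * diagFactor (u t) +
        upperFactor (u t) * (Matrix.diagonal (diagPart v) * diagFactor (u t))) *
          lowerFactor (u t) + upperFactor (u t) * diagFactor (u t) * lowerPart v) t := by
  have h1 := (hu.linearMap_matrix upperPart).matrix_const_add 1
  have h3 := (hu.linearMap_matrix lowerPart).matrix_const_add 1
  have h2 : HasDerivAt (fun s => diagFactor (u s))
      (Matrix.diagonal (diagPart v) * diagFactor (u t)) t := by
    have h : HasDerivAt (fun s i => Complex.exp (diagPart (u s) i))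
        (fun i => diagPart v i * Complex.exp (diagPart (u t) i)) t := by
      refine hasDerivAt_pi.2 fun i => ?_
      have h4 : HasDerivAt (fun s => diagPart (u s) i) (diagPart v i) t :=
        hasDerivAt_pi.1 (((LinearMap.toContinuousLinearMap diagPart).restrictScalars ℝ
          ).hasFDerivAt.comp_hasDerivAt t hu) i
      simpa [mul_comm] using h4.cexp
    have := h.linearMap_matrix (Matrix.diagonalLinearMap (Fin N) ℂ ℂ)
    rw [diagFactor, Matrix.diagonal_mul_diagonal]
    exact this
  exact (h1.matrix_mul h2).matrix_mul h3

/-- `U⁻¹ M U`, where `M = ∑ a_k X_k` and `U` is the upper triangular factor. -/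
noncomputable def conjGenerator (a u : WNIndex N → ℂ) : Matrix (Fin N) (Fin N) ℂ :=
  (upperFactor u)⁻¹ * generatorMatrix a * upperFactor u

theorem trace_generatorMatrix (a : WNIndex N → ℂ) : (generatorMatrix a).trace = 0 := by
  rw [generatorMatrix_eq, Matrix.trace]
  simp [upperPart_eq_zero, lowerPart_eq_zero, sum_diagPart_eq_zero]

theorem trace_conjGenerator (a u : WNIndex N → ℂ) : ∑ i, conjGenerator a u i i = 0 := by
  have : (conjGenerator a u).trace = 0 := by
    rw [conjGenerator, Matrix.trace_mul_comm, ← mul_assoc, upperFactor_mul_inv, one_mul,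
      trace_generatorMatrix]
  exact this

variable {X : Module.Basis (WNIndex N) ℂ (SLC N)}

/-- The Wei–Norman system, multiplied by `U⁻¹` from the left and by `K⁻¹ U` from the right. -/
theorem wnMatrix_mulVec_eq_iff (hX : IsWNBasis N X) (a u v : WNIndex N → ℂ) :
    (wnMatrix X u).mulVec v = a ↔
      (upperFactor u)⁻¹ * upperPart v + Matrix.diagonal (diagPart v) +
        diagFactor u * (lowerPart v * (lowerFactor u)⁻¹) * diagFactorInv u =
          conjGenerator a u := by
  -- compare two expressions for the derivative of `K` along the line through `u` in direction `v`
  have hu : HasDerivAt (fun s : ℝ => u + s • v) v 0 := by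
    simpa using ((hasDerivAt_id (0 : ℝ)).smul_const v).const_add u
  have h1 := hasDerivAt_wnProduct X hu
  have h2 := hasDerivAt_factors hu
  simp only [wnProduct_eq hX] at h1
  have h3 := h1.matrix_unique h2
  simp only [zero_smul, add_zero, wnGenerator_eq hX] at h3
  have hinj : (wnMatrix X u).mulVec v = a ↔
      generatorMatrix ((wnMatrix X u).mulVec v) = generatorMatrix a := by
    rw [← wnGenerator_eq hX, ← wnGenerator_eq hX, (wnGenerator_injective X).eq_iff]
  rw [hinj]
  set U := upperFactor u
  set D := diagFactor u
  set L := lowerFactor u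
  set A := generatorMatrix ((wnMatrix X u).mulVec v)
  have hU : U⁻¹ * U = 1 := upperFactor_inv_mul u
  have hU' : U * U⁻¹ = 1 := upperFactor_mul_inv u
  have hL' : L * L⁻¹ = 1 := lowerFactor_mul_inv u
  have hD' : D * diagFactorInv u = 1 := diagFactor_mul_inv u
  have key : U⁻¹ * A * U = U⁻¹ * upperPart v + Matrix.diagonal (diagPart v) +
      D * (lowerPart v * L⁻¹) * diagFactorInv u := by
    have e1 : U⁻¹ * A * U = U⁻¹ * (A * (U * D * L)) * (L⁻¹ * diagFactorInv u) := by
      calc U⁻¹ * A * U = U⁻¹ * A * U * (D * ((L * L⁻¹) * diagFactorInv u)) := by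
            rw [hL', one_mul, hD', mul_one]
        _ = _ := by noncomm_ring
    rw [e1, h3]
    calc _ = U⁻¹ * upperPart v * (D * ((L * L⁻¹) * diagFactorInv u)) +
          (U⁻¹ * U) * Matrix.diagonal (diagPart v) * (D * ((L * L⁻¹) * diagFactorInv u)) +
          (U⁻¹ * U) * (D * (lowerPart v * L⁻¹) * diagFactorInv u) := by noncomm_ring
      _ = _ := by rw [hL', hU, one_mul, hD', mul_one, one_mul, one_mul, mul_one]
  rw [← key, conjGenerator]
  constructor
  · intro h
    rw [h]
  · intro h
    calc A = (U * U⁻¹) * A * (U * U⁻¹) := by rw [hU', one_mul, mul_one]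
      _ = U * (U⁻¹ * A * U) * U⁻¹ := by noncomm_ring
      _ = (U * U⁻¹) * generatorMatrix a * (U * U⁻¹) := by rw [h]; noncomm_ring
      _ = _ := by rw [hU', one_mul, mul_one]

/-- The entries above the diagonal. -/
def strictUpper (B : Matrix (Fin N) (Fin N) ℂ) : Matrix (Fin N) (Fin N) ℂ :=
  Matrix.of fun p q => if p < q then B p q else 0

/-- The entries below the diagonal. -/
def strictLower (B : Matrix (Fin N) (Fin N) ℂ) : Matrix (Fin N) (Fin N) ℂ :=
  Matrix.of fun p q => if q < p then B p q else 0

/-- The Wei–Norman system splits into three systems, one for the unknowns above the diagonal, one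
for the Cartan unknowns, and one for the unknowns below the diagonal. -/
theorem wnMatrix_mulVec_eq_iff_parts (hX : IsWNBasis N X) (a u v : WNIndex N → ℂ) :
    (wnMatrix X u).mulVec v = a ↔
      upperPart v = upperFactor u * strictUpper (conjGenerator a u) ∧
      diagPart v = (fun i => conjGenerator a u i i) ∧
      lowerPart v = diagFactorInv u * strictLower (conjGenerator a u) * diagFactor u *
        lowerFactor u := by
  rw [wnMatrix_mulVec_eq_iff hX]
  generalize conjGenerator a u = B
  set P := (upperFactor u)⁻¹ * upperPart v with hP
  set R := diagFactor u * (lowerPart v * (lowerFactor u)⁻¹) * diagFactorInv u with hR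
  have hP0 : ∀ p q, q ≤ p → P p q = 0 := fun p q h => by
    rw [hP, Matrix.mul_apply]
    refine Finset.sum_eq_zero fun r _ => ?_
    rcases lt_or_ge r p with hr | hr
    · rw [upperFactor_inv_eq_zero u hr, zero_mul]
    · rw [upperPart_eq_zero v (h.trans hr), mul_zero]
  have hR0 : ∀ p q, p ≤ q → R p q = 0 := fun p q h => by
    rw [hR, diagFactor, diagFactorInv, Matrix.mul_diagonal, Matrix.diagonal_mul,
      Matrix.mul_apply, Finset.sum_eq_zero, mul_zero, zero_mul]
    intro r _
    rcases lt_or_ge r p with hr | hr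
    · rw [lowerFactor_inv_eq_zero u (hr.trans_le h), mul_zero]
    · rw [lowerPart_eq_zero v hr, zero_mul]
  have hsplit : P + Matrix.diagonal (diagPart v) + R = B ↔
      P = strictUpper B ∧ diagPart v = (fun i => B i i) ∧ R = strictLower B := by
    constructor
    · rintro rfl
      refine ⟨?_, ?_, ?_⟩
      · ext p q
        simp only [strictUpper, Matrix.of_apply, Matrix.add_apply]
        split_ifs with h
        · rw [Matrix.diagonal_apply_ne _ h.ne, hR0 p q h.le, add_zero, add_zero]
        · exact hP0 p q (not_lt.1 h)
      · ext i
        simp [hP0 i i le_rfl, hR0 i i le_rfl]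
      · ext p q
        simp only [strictLower, Matrix.of_apply, Matrix.add_apply]
        split_ifs with h
        · rw [Matrix.diagonal_apply_ne _ h.ne', hP0 p q h.le, add_zero, zero_add]
        · exact hR0 p q (not_lt.1 h)
    · rintro ⟨h1, h2, h3⟩
      rw [h1, h2, h3]
      ext p q
      rcases lt_trichotomy p q with h | rfl | h
      · simp [strictUpper, strictLower, h, h.not_gt, h.ne]
      · simp [strictUpper, strictLower]
      · simp [strictUpper, strictLower, h, h.not_gt, h.ne']
  rw [hsplit]
  refine and_congr ?_ (and_congr Iff.rfl ?_)
  · constructor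
    · intro h
      rw [← h, hP, ← mul_assoc, upperFactor_mul_inv, one_mul]
    · intro h
      rw [hP, h, ← mul_assoc, upperFactor_inv_mul, one_mul]
  · constructor
    · intro h
      rw [← h, hR]
      calc lowerPart v = (diagFactorInv u * diagFactor u) * lowerPart v *
            ((lowerFactor u)⁻¹ * ((diagFactorInv u * diagFactor u) * lowerFactor u)) := by
            rw [diagFactorInv_mul, one_mul, one_mul, lowerFactor_inv_mul, mul_one]
        _ = _ := by noncomm_ring
    · intro h
      rw [hR, h]
      calc _ = (diagFactor u * diagFactorInv u) * strictLower B *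
            (diagFactor u * ((lowerFactor u * (lowerFactor u)⁻¹) * diagFactorInv u)) := by
            noncomm_ring
        _ = _ := by
            rw [lowerFactor_mul_inv, one_mul, diagFactor_mul_inv, one_mul, mul_one]

end Equations

/-! ### Coefficients of the hierarchy -/

section Coefficients

variable {n : ℕ} {s : Finset (Fin n)}

theorem IsWNCoeff.sub {φ ψ : (Fin n → ℂ) → (Fin n → ℂ) → ℂ} (hφ : IsWNCoeff s φ)
    (hψ : IsWNCoeff s ψ) : IsWNCoeff s fun a u => φ a u - ψ a u :=
  ⟨fun u => ((hφ.linear u).mk' _ - (hψ.linear u).mk' _).isLinear,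
    fun a => (hφ.entire a).sub (hψ.entire a), fun a x y hxy => by
      simp only [hφ.dependsOn a hxy, hψ.dependsOn a hxy]⟩

theorem isWNCoeff_zero : IsWNCoeff s fun _ _ => 0 :=
  ⟨fun _ => ⟨fun _ _ => (add_zero 0).symm, fun _ _ => (smul_zero _).symm⟩,
    fun _ => differentiable_const _, fun _ _ _ _ => rfl⟩

theorem IsWNCoeff.neg {φ : (Fin n → ℂ) → (Fin n → ℂ) → ℂ} (hφ : IsWNCoeff s φ) :
    IsWNCoeff s fun a u => -φ a u := by
  simpa using isWNCoeff_zero.sub hφ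

theorem IsWNCoeff.add {φ ψ : (Fin n → ℂ) → (Fin n → ℂ) → ℂ} (hφ : IsWNCoeff s φ)
    (hψ : IsWNCoeff s ψ) : IsWNCoeff s fun a u => φ a u + ψ a u := by
  simpa using hφ.sub hψ.neg

theorem IsWNCoeff.sum {ι : Type*} (T : Finset ι) {φ : ι → (Fin n → ℂ) → (Fin n → ℂ) → ℂ}
    (hφ : ∀ i ∈ T, IsWNCoeff s (φ i)) : IsWNCoeff s fun a u => ∑ i ∈ T, φ i a u := by
  classical
  induction T using Finset.induction_on with
  | empty => simpa using isWNCoeff_zero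
  | insert i T hi ih =>
    simp only [Finset.sum_insert hi]
    exact (hφ i (Finset.mem_insert_self i T)).add
      (ih fun j hj => hφ j (Finset.mem_insert_of_mem hj))

theorem IsWNCoeff.mul_left {g : (Fin n → ℂ) → ℂ} (hg : Differentiable ℂ g)
    (hg' : DependsOn g (s : Set (Fin n))) {φ : (Fin n → ℂ) → (Fin n → ℂ) → ℂ}
    (hφ : IsWNCoeff s φ) : IsWNCoeff s fun a u => g u * φ a u :=
  ⟨fun u => ⟨fun a b => by rw [(hφ.linear u).map_add, mul_add],
      fun c a => by rw [(hφ.linear u).map_smul, smul_eq_mul, smul_eq_mul]; ring⟩,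
    fun a => hg.mul (hφ.entire a), fun a x y hxy => by
      simp only [hφ.dependsOn a hxy, hg' hxy]⟩

theorem IsWNCoeff.mul_right {g : (Fin n → ℂ) → ℂ} (hg : Differentiable ℂ g)
    (hg' : DependsOn g (s : Set (Fin n))) {φ : (Fin n → ℂ) → (Fin n → ℂ) → ℂ}
    (hφ : IsWNCoeff s φ) : IsWNCoeff s fun a u => φ a u * g u := by
  simpa only [mul_comm] using hφ.mul_left hg hg'

/-- A coefficient is continuous along a curve of which only the components that it involves are
known to be continuous. -/
theorem IsWNCoeff.continuousOn {φ : (Fin n → ℂ) → (Fin n → ℂ) → ℂ} (hφ : IsWNCoeff s φ)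
    {I : Set ℝ} {a u : ℝ → Fin n → ℂ} (ha : ContinuousOn a I)
    (hu : ∀ i ∈ s, ContinuousOn (fun t => u t i) I) :
    ContinuousOn (fun t => φ (a t) (u t)) I := by
  classical
  have h1 : ∀ t, φ (a t) (u t) =
      ∑ k, a t k * φ (Pi.single k 1) (fun i => if i ∈ s then u t i else 0) := by
    intro t
    have h2 : φ (a t) (u t) = φ (a t) (fun i => if i ∈ s then u t i else 0) :=
      hφ.dependsOn (a t) fun i hi => (if_pos (Finset.mem_coe.1 hi)).symm
    have h3 := LinearMap.pi_apply_eq_sum_univ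
      ((hφ.linear (fun i => if i ∈ s then u t i else 0)).mk' _) (a t)
    rw [h2]
    refine h3.trans (Finset.sum_congr rfl fun k _ => ?_)
    rw [IsLinearMap.mk'_apply, smul_eq_mul]
    congr 2
    ext i
    simp [Pi.single_apply, eq_comm]
  simp only [h1]
  refine continuousOn_finsetSum _ fun k _ => ((continuousOn_pi.1 ha) k).mul ?_
  refine (hφ.entire _).continuous.comp_continuousOn (continuousOn_pi.2 fun i => ?_)
  by_cases hi : i ∈ s
  · simpa [hi] using hu i hi
  · simpa [hi] using continuousOn_const

end Coefficients

section TriangularCoefficients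

variable {N : ℕ}

theorem dependsOn_upperPart {s : Set (WNIndex N)} {p q : Fin N}
    (h : ∀ m, wnRow m = p → wnCol m = q → p < q → m ∈ s) :
    DependsOn (fun u => upperPart u p q) s := by
  intro x y hxy
  by_cases hpq : p < q
  · obtain ⟨m, rfl, rfl⟩ := exists_position_of_ne hpq.ne
    simp only [upperPart_apply _ hpq]
    exact hxy m (h m rfl rfl hpq)
  · simp only [upperPart_eq_zero _ (not_lt.1 hpq)]

theorem dependsOn_upperFactor {s : Set (WNIndex N)} {p q : Fin N}
    (h : ∀ m, wnRow m = p → wnCol m = q → p < q → m ∈ s) :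
    DependsOn (fun u => upperFactor u p q) s := by
  intro x y hxy
  simp only [upperFactor_apply]
  rw [show upperPart x p q = upperPart y p q from dependsOn_upperPart h hxy]

/-- The rows of `U⁻¹` from `q` on only involve the columns of `U` after `q`. -/
theorem dependsOn_upperFactor_inv {s : Set (WNIndex N)} {q r : Fin N} (hr : q ≤ r)
    (h : ∀ m, wnRow m < wnCol m → q < wnCol m → m ∈ s) (j : Fin N) :
    DependsOn (fun u => (upperFactor u)⁻¹ r j) s := by
  intro x y hxy
  -- if `x` and `y` agree on these columns, row `r` of `U(x)⁻¹` also inverts `U(y)`, because it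
  -- vanishes to the left of the diagonal and the rows of `U` from `r` on only meet later columns
  have h1 : ∀ t, ((upperFactor x)⁻¹ * upperFactor y) r t =
      ((upperFactor x)⁻¹ * upperFactor x) r t := by
    intro t
    rw [Matrix.mul_apply, Matrix.mul_apply]
    refine Finset.sum_congr rfl fun i _ => ?_
    rcases lt_or_ge i r with hi | hi
    · rw [upperFactor_inv_eq_zero x hi, zero_mul, zero_mul]
    · congr 1
      refine (dependsOn_upperFactor (s := s) (fun m h1 h2 h3 => ?_) hxy).symm
      subst h1 h2
      exact h m h3 ((hr.trans hi).trans_lt h3)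
  calc (upperFactor x)⁻¹ r j = ((upperFactor x)⁻¹ * upperFactor y * (upperFactor y)⁻¹) r j := by
        rw [mul_assoc, upperFactor_mul_inv, mul_one]
    _ = ∑ t, ((upperFactor x)⁻¹ * upperFactor x) r t * (upperFactor y)⁻¹ t j := by
        rw [Matrix.mul_apply]
        exact Finset.sum_congr rfl fun t _ => by rw [h1]
    _ = (upperFactor y)⁻¹ r j := by
        rw [← Matrix.mul_apply, upperFactor_inv_mul, one_mul]

theorem differentiable_upperPart (p q : Fin N) :
    Differentiable ℂ fun u : WNIndex N → ℂ => upperPart u p q :=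
  (LinearMap.toContinuousLinearMap
    ((Matrix.entryLinearMap ℂ ℂ p q : Matrix (Fin N) (Fin N) ℂ →ₗ[ℂ] ℂ) ∘ₗ
      upperPart)).differentiable

theorem differentiable_upperFactor (p q : Fin N) :
    Differentiable ℂ fun u : WNIndex N → ℂ => upperFactor u p q :=
  (differentiable_upperPart p q).const_add _

theorem differentiable_diagPart (i : Fin N) :
    Differentiable ℂ fun u : WNIndex N → ℂ => diagPart u i :=
  (LinearMap.toContinuousLinearMap
    (LinearMap.proj (R := ℂ) (φ := fun _ : Fin N => ℂ) i ∘ₗ diagPart)).differentiable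

theorem differentiable_upperFactor_inv (p q : Fin N) :
    Differentiable ℂ fun u : WNIndex N → ℂ => (upperFactor u)⁻¹ p q :=
  differentiable_matrix_inv (LinearMap.toContinuousLinearMap upperPart) 1 isUnit_upperFactor p q

theorem dependsOn_diagPart {s : Set (WNIndex N)} (h : ∀ m, wnRow m = wnCol m → m ∈ s)
    (i : Fin N) : DependsOn (fun u : WNIndex N → ℂ => diagPart u i) s := by
  intro x y hxy
  refine congrFun (?_ : diagPart x = diagPart y) i
  simp only [diagPart, Fintype.linearCombination_apply]
  refine Finset.sum_congr rfl fun m _ => ?_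
  split_ifs with hm
  · rw [hxy m (h m hm)]
  · simp

theorem isWNCoeff_generatorMatrix (s : Finset (WNIndex N)) (p q : Fin N) :
    IsWNCoeff s fun a _ => generatorMatrix a p q :=
  ⟨fun _ => ((Matrix.entryLinearMap ℂ ℂ p q : Matrix (Fin N) (Fin N) ℂ →ₗ[ℂ] ℂ) ∘ₗ
      generatorMatrix).isLinear,
    fun _ => differentiable_const _, fun _ _ _ _ => rfl⟩

/-- `U⁻¹ M`. -/
noncomputable def leftGenerator (a u : WNIndex N → ℂ) : Matrix (Fin N) (Fin N) ℂ :=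
  (upperFactor u)⁻¹ * generatorMatrix a

theorem isWNCoeff_leftGenerator {s : Finset (WNIndex N)} {q r : Fin N} (hr : q ≤ r)
    (h : ∀ m, wnRow m < wnCol m → q < wnCol m → m ∈ s) (j : Fin N) :
    IsWNCoeff s fun a u => leftGenerator a u r j := by
  simp only [leftGenerator, Matrix.mul_apply]
  exact IsWNCoeff.sum _ fun i _ => (isWNCoeff_generatorMatrix s i j).mul_left
    (differentiable_upperFactor_inv r i) (dependsOn_upperFactor_inv hr h i)

theorem isWNCoeff_conjGenerator {s : Finset (WNIndex N)}
    (h : ∀ m, wnRow m < wnCol m → m ∈ s) (p q : Fin N) :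
    IsWNCoeff s fun a u => conjGenerator a u p q := by
  have e : ∀ a u, conjGenerator a u p q = ∑ r, leftGenerator a u p r * upperFactor u r q :=
    fun a u => Matrix.mul_apply
  simp only [e]
  exact IsWNCoeff.sum _ fun i _ => (isWNCoeff_leftGenerator le_rfl (fun m hm _ => h m hm) i
    ).mul_right (differentiable_upperFactor i q) (dependsOn_upperFactor fun m h1 h2 h3 => by
      subst h1 h2
      exact h m h3)

/-- The entry `(p, j)` of `M - ∑_{r > q} U_{pr} (r-th row of U⁻¹ M)`. It involves the columns of `U`
after `q` only, and yields the constant and linear terms of the Riccati equations of column `q`. -/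
noncomputable def reducedRow (p q j : Fin N) (a u : WNIndex N → ℂ) : ℂ :=
  generatorMatrix a p j - ∑ r ∈ Finset.Ioi q, upperFactor u p r * leftGenerator a u r j

theorem isWNCoeff_reducedRow {s : Finset (WNIndex N)} {q : Fin N}
    (h : ∀ m, wnRow m < wnCol m → q < wnCol m → m ∈ s) (p j : Fin N) :
    IsWNCoeff s (reducedRow p q j) := by
  refine (isWNCoeff_generatorMatrix s p j).sub (IsWNCoeff.sum _ fun r hr => ?_)
  have hr' := Finset.mem_Ioi.1 hr
  refine (isWNCoeff_leftGenerator hr'.le h j).mul_left (differentiable_upperFactor p r)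
    (dependsOn_upperFactor fun m h1 h2 h3 => ?_)
  subst h1 h2
  exact h m h3 hr'

/-- The strictly lower triangular part of `U⁻¹ M U`, conjugated by the diagonal factor. -/
noncomputable def scaledLower (a u : WNIndex N → ℂ) : Matrix (Fin N) (Fin N) ℂ :=
  diagFactorInv u * strictLower (conjGenerator a u) * diagFactor u

theorem scaledLower_apply (a u : WNIndex N → ℂ) {p q : Fin N} (h : q < p) :
    scaledLower a u p q =
      Complex.exp (diagPart u q - diagPart u p) * conjGenerator a u p q := by
  simp only [scaledLower, diagFactorInv, diagFactor, Matrix.mul_diagonal, Matrix.diagonal_mul,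
    strictLower, Matrix.of_apply, if_pos h]
  rw [sub_eq_add_neg, Complex.exp_add]
  ring

theorem scaledLower_eq_zero (a u : WNIndex N → ℂ) {p q : Fin N} (h : p ≤ q) :
    scaledLower a u p q = 0 := by
  simp [scaledLower, diagFactorInv, diagFactor, Matrix.mul_diagonal, Matrix.diagonal_mul,
    strictLower, if_neg h.not_gt]

theorem isWNCoeff_scaledLower {s : Finset (WNIndex N)} (h : ∀ m, wnRow m ≤ wnCol m → m ∈ s)
    {p q : Fin N} (hpq : q < p) : IsWNCoeff s fun a u => scaledLower a u p q := by
  simp only [scaledLower_apply _ _ hpq]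
  refine (isWNCoeff_conjGenerator (fun m hm => h m hm.le) p q).mul_left
    ((differentiable_diagPart q).sub (differentiable_diagPart p)).cexp fun x y hxy => ?_
  have hd := fun i => dependsOn_diagPart (s := (s : Set (WNIndex N)))
    (fun m hm => h m hm.le) i hxy
  simp only at hd
  simp only [Pi.sub_apply, hd]

theorem mul_upperFactor_apply (A : Matrix (Fin N) (Fin N) ℂ) (u : WNIndex N → ℂ) (p q : Fin N) :
    (A * upperFactor u) p q = A p q + ∑ j, A p j * upperPart u j q := by
  rw [upperFactor, mul_add, mul_one, Matrix.add_apply, Matrix.mul_apply]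

theorem mul_lowerFactor_apply (A : Matrix (Fin N) (Fin N) ℂ) (u : WNIndex N → ℂ) (p q : Fin N) :
    (A * lowerFactor u) p q = A p q + ∑ j, A p j * lowerPart u j q := by
  rw [lowerFactor, mul_add, mul_one, Matrix.add_apply, Matrix.mul_apply]

/-- The equation for `U`, column by column, is a matrix Riccati equation. -/
theorem upperFactor_mul_strictUpper_apply (a u : WNIndex N → ℂ) {p q : Fin N} (h : p < q) :
    (upperFactor u * strictUpper (conjGenerator a u)) p q =
      reducedRow p q q a u + ∑ j, reducedRow p q j a u * upperPart u j q -
        upperPart u p q *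
          (leftGenerator a u q q + ∑ j, leftGenerator a u q j * upperPart u j q) := by
  have hZU : conjGenerator a u = leftGenerator a u * upperFactor u := rfl
  have h1 : (upperFactor u * strictUpper (conjGenerator a u)) p q =
      (generatorMatrix a * upperFactor u) p q -
        ∑ r ∈ Finset.Ici q, upperFactor u p r * conjGenerator a u r q := by
    have h2 : generatorMatrix a * upperFactor u = upperFactor u * conjGenerator a u := by
      rw [conjGenerator, mul_assoc, ← mul_assoc (upperFactor u), upperFactor_mul_inv, one_mul]
    have h3 : Finset.univ.filter (fun r => ¬r < q) = Finset.Ici q := by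
      ext r
      simp
    rw [h2, Matrix.mul_apply, Matrix.mul_apply,
      ← Finset.sum_filter_add_sum_filter_not Finset.univ (· < q)
        fun r => upperFactor u p r * conjGenerator a u r q, h3, add_sub_cancel_right,
      Finset.sum_filter]
    exact Finset.sum_congr rfl fun r _ => by simp [strictUpper]
  have h4 : upperFactor u p q = upperPart u p q := by
    rw [upperFactor_apply, Matrix.one_apply_ne h.ne, zero_add]
  -- split off the term `r = q`, the only one that is quadratic in column `q`
  rw [h1, ← Finset.Ioi_insert, Finset.sum_insert (by simp), h4, hZU]
  simp only [mul_upperFactor_apply, reducedRow, sub_mul, Finset.sum_sub_distrib, mul_add,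
    Finset.sum_add_distrib, Finset.sum_mul, Finset.mul_sum, mul_assoc]
  rw [Finset.sum_comm (s := Finset.univ) (t := Finset.Ioi q)]
  ring

/-- A sum over the block of a column is a sum over the rows. -/
theorem sum_upperBlock {k : ℕ} (hk : k ∈ Finset.Ico 1 N) {q : Fin N} (hq : (q : ℕ) + k = N)
    (F : Fin N → ℂ) (u : WNIndex N → ℂ) :
    ∑ j ∈ upperBlock N k, F (wnRow j) * u j = ∑ r, F r * upperPart u r q := by
  have hcol : ∀ {j}, j ∈ upperBlock N k ↔ wnRow j < q ∧ wnCol j = q := fun {j} => by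
    rw [mem_upperBlock hk]
    constructor
    · rintro ⟨h1, h2⟩
      have : wnCol j = q := Fin.ext (by omega)
      exact ⟨this ▸ h1, this⟩
    · rintro ⟨h1, rfl⟩
      exact ⟨h1, hq⟩
  have h0 : ∑ r, F r * upperPart u r q = ∑ r ∈ Finset.Iio q, F r * upperPart u r q := by
    refine (Finset.sum_subset (Finset.subset_univ _) fun r _ hr => ?_).symm
    rw [upperPart_eq_zero u (not_lt.1 (mt Finset.mem_Iio.2 hr)), mul_zero]
  rw [h0]
  refine Finset.sum_bij (fun j _ => wnRow j) (fun j hj => Finset.mem_Iio.2 (hcol.1 hj).1)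
    (fun i hi j hj hij => position_ext hij ((hcol.1 hi).2.trans (hcol.1 hj).2.symm))
    (fun r hr => ?_) (fun j hj => ?_)
  · obtain ⟨j, h1, h2⟩ := exists_position_of_ne (Finset.mem_Iio.1 hr).ne
    exact ⟨j, hcol.2 ⟨by rw [h1]; exact Finset.mem_Iio.1 hr, h2⟩, h1⟩
  · obtain ⟨h1, h2⟩ := hcol.1 hj
    subst h2
    rw [upperPart_apply u h1]

/-- A sum over the entries in column `q` of the lower blocks above row `p`. -/
theorem sum_lowerBlock {k : ℕ} (hk : k ∈ Finset.Ico 1 N) {p q : Fin N} (hp : (p : ℕ) + k = N)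
    (F : Fin N → ℂ) (hF : ∀ r, p ≤ r → F r = 0) (u : WNIndex N → ℂ) :
    ∑ l ∈ Finset.Ioo k N, ∑ j ∈ lowerBlock N l,
      (if wnCol j = q then F (wnRow j) else 0) * u j = ∑ r, F r * lowerPart u r q := by
  have hk1 := (Finset.mem_Ico.1 hk).1
  set S : Finset (WNIndex N) := Finset.univ.filter fun j => wnCol j < wnRow j ∧ wnRow j < p
    with hS
  -- the blocks with `k < l < N` are the rows above row `p`
  have h1 : ∑ l ∈ Finset.Ioo k N, ∑ j ∈ lowerBlock N l,
      (if wnCol j = q then F (wnRow j) else 0) * u j =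
        ∑ j ∈ S, (if wnCol j = q then F (wnRow j) else 0) * u j := by
    rw [← Finset.sum_fiberwise_of_maps_to (s := S) (t := Finset.Ioo k N)
      (g := fun j => N - (wnRow j : ℕ))]
    · refine Finset.sum_congr rfl fun l hl => Finset.sum_congr ?_ fun _ _ => rfl
      obtain ⟨hl1, hl2⟩ := Finset.mem_Ioo.1 hl
      ext j
      have := (wnRow j).2
      rw [mem_lowerBlock (Finset.mem_Ico.2 ⟨by omega, hl2⟩), Finset.mem_filter, hS,
        Finset.mem_filter, Fin.lt_def, Fin.lt_def]
      simp only [Finset.mem_univ, true_and]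
      omega
    · intro j hj
      obtain ⟨h1, h2⟩ := (Finset.mem_filter.1 hj).2
      have := (wnRow j).2
      rw [Fin.lt_def] at h1 h2
      rw [Finset.mem_Ioo]
      omega
  have h2 : ∑ r, F r * lowerPart u r q =
      ∑ r ∈ Finset.univ.filter (fun r => q < r ∧ r < p), F r * lowerPart u r q := by
    refine (Finset.sum_subset (Finset.subset_univ _) fun r _ hr => ?_).symm
    rcases le_or_gt p r with h | h
    · rw [hF r h, zero_mul]
    · rw [lowerPart_eq_zero u (not_lt.1 fun h' => hr (by simp [h, h'])), mul_zero]
  have h3 : ∀ j, (if wnCol j = q then F (wnRow j) else 0) * u j =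
      if wnCol j = q then F (wnRow j) * u j else 0 := fun j => by
    split_ifs <;> simp
  rw [h1, h2]
  simp only [h3]
  rw [← Finset.sum_filter]
  refine Finset.sum_bij (fun j _ => wnRow j) (fun j hj => ?_) (fun i hi j hj hij => ?_)
    (fun r hr => ?_) (fun j hj => ?_)
  · simp only [hS, Finset.mem_filter, Finset.mem_univ, true_and] at hj ⊢
    rw [← hj.2]
    exact hj.1
  · exact position_ext hij ((Finset.mem_filter.1 hi).2.trans (Finset.mem_filter.1 hj).2.symm)
  · simp only [Finset.mem_filter, Finset.mem_univ, true_and] at hr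
    obtain ⟨j, h1, h2⟩ := exists_position_of_ne hr.1.ne'
    refine ⟨j, ?_, h1⟩
    simp only [hS, Finset.mem_filter, Finset.mem_univ, true_and, h1, h2]
    exact ⟨hr, trivial⟩
  · simp only [hS, Finset.mem_filter, Finset.mem_univ, true_and] at hj
    obtain ⟨h4, h5⟩ := hj
    subst h5
    rw [lowerPart_apply u h4.1]

/-! ### The hierarchy -/

/-- The hierarchy. For the block of column `q` the coefficients of the Riccati equations are entries
of `U⁻¹ M` and of `M` reduced by the columns after `q`; the Cartan unknowns are the partial sums of
the diagonal of `U⁻¹ M U`; the lower unknowns are driven by the entries of `D⁻¹ U⁻¹ M U D` below the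
diagonal. -/
noncomputable def triangularHierarchy (N : ℕ) : WNHierarchy N where
  c i := reducedRow (wnRow i) (wnCol i) (wnCol i)
  C i j a u := reducedRow (wnRow i) (wnCol i) (wnRow j) a u -
    if wnRow j = wnRow i then leftGenerator a u (wnCol i) (wnCol i) else 0
  b j a u := -leftGenerator a u (wnCol j) (wnRow j)
  f i a u := ∑ l ∈ Finset.Iic (wnRow i), conjGenerator a u l l
  h i a u := scaledLower a u (wnRow i) (wnCol i)
  L i j a u := if wnCol j = wnCol i then scaledLower a u (wnRow i) (wnRow j) else 0
  c_coeff k hk i hi := by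
    have hi' := (mem_upperBlock hk).1 hi
    refine isWNCoeff_reducedRow (fun m h1 h2 => ?_) _ _
    rw [mem_upperBefore (Finset.mem_Ico.1 hk).2.le]
    exact ⟨h1, by rw [Fin.lt_def] at h2; omega⟩
  C_coeff k hk i hi j hj := by
    have hi' := (mem_upperBlock hk).1 hi
    have hs : ∀ m, wnRow m < wnCol m → wnCol i < wnCol m → m ∈ upperBefore N k := by
      intro m h1 h2
      rw [mem_upperBefore (Finset.mem_Ico.1 hk).2.le]
      exact ⟨h1, by rw [Fin.lt_def] at h2; omega⟩
    refine (isWNCoeff_reducedRow hs _ _).sub ?_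
    split_ifs
    · exact isWNCoeff_leftGenerator le_rfl hs _
    · exact isWNCoeff_zero
  b_coeff k hk i hi := by
    have hi' := (mem_upperBlock hk).1 hi
    refine (isWNCoeff_leftGenerator le_rfl (fun m h1 h2 => ?_) _).neg
    rw [mem_upperBefore (Finset.mem_Ico.1 hk).2.le]
    exact ⟨h1, by rw [Fin.lt_def] at h2; omega⟩
  f_coeff i hi := IsWNCoeff.sum _ fun l _ =>
    isWNCoeff_conjGenerator (fun m hm => mem_upperBefore_self.2 hm) l l
  h_coeff k hk i hi := by
    refine isWNCoeff_scaledLower (fun m hm => ?_) ((mem_lowerBlock hk).1 hi).1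
    rw [Finset.mem_union, mem_upperBefore_self, mem_cartanBlock]
    exact hm.lt_or_eq
  L_coeff k hk i hi l hl j hj := by
    have hi' := (mem_lowerBlock hk).1 hi
    obtain ⟨hl1, hl2⟩ := Finset.mem_Ioo.1 hl
    have hj' := (mem_lowerBlock (Finset.mem_Ico.2 ⟨by omega, hl2⟩)).1 hj
    split_ifs
    · refine isWNCoeff_scaledLower (fun m hm => ?_) (by rw [Fin.lt_def]; omega)
      rw [Finset.mem_union, mem_upperBefore_self, mem_cartanBlock]
      exact hm.lt_or_eq
    · exact isWNCoeff_zero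

theorem riccati_triangularHierarchy {k : ℕ} (hk : k ∈ Finset.Ico 1 N) {i : WNIndex N}
    (hi : i ∈ upperBlock N k) (a u : WNIndex N → ℂ) :
    (triangularHierarchy N).riccati k i a u =
      (upperFactor u * strictUpper (conjGenerator a u)) (wnRow i) (wnCol i) := by
  obtain ⟨h1, h2⟩ := (mem_upperBlock hk).1 hi
  have hb : ∑ j ∈ upperBlock N k, u j * -leftGenerator a u (wnCol j) (wnRow j) =
      ∑ j ∈ upperBlock N k, -leftGenerator a u (wnCol i) (wnRow j) * u j := by
    refine Finset.sum_congr rfl fun j hj => ?_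
    have h3 := ((mem_upperBlock hk).1 hj).2
    rw [show wnCol j = wnCol i from Fin.ext (by omega), mul_comm]
  rw [upperFactor_mul_strictUpper_apply a u h1]
  simp only [WNHierarchy.riccati, triangularHierarchy]
  rw [hb, sum_upperBlock hk h2 (fun r => -leftGenerator a u (wnCol i) r),
    sum_upperBlock hk h2 (fun r => reducedRow (wnRow i) (wnCol i) r a u -
      if r = wnRow i then leftGenerator a u (wnCol i) (wnCol i) else 0), ← upperPart_apply u h1]
  simp only [sub_mul, Finset.sum_sub_distrib, ite_mul, zero_mul, Finset.sum_ite_eq',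
    Finset.mem_univ, if_true, neg_mul, Finset.sum_neg_distrib]
  ring

theorem linearRhs_triangularHierarchy {k : ℕ} (hk : k ∈ Finset.Ico 1 N) {i : WNIndex N}
    (hi : i ∈ lowerBlock N k) (a u : WNIndex N → ℂ) :
    (triangularHierarchy N).linearRhs k i a u =
      (scaledLower a u * lowerFactor u) (wnRow i) (wnCol i) := by
  obtain ⟨h1, h2⟩ := (mem_lowerBlock hk).1 hi
  rw [mul_lowerFactor_apply]
  simp only [WNHierarchy.linearRhs, triangularHierarchy]
  rw [sum_lowerBlock hk h2 (fun r => scaledLower a u (wnRow i) r)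
    (fun r hr => scaledLower_eq_zero a u hr)]

theorem exists_mem_upperBlock {m : WNIndex N} (h : wnRow m < wnCol m) :
    ∃ k ∈ Finset.Ico 1 N, m ∈ upperBlock N k := by
  have hk : N - (wnCol m : ℕ) ∈ Finset.Ico 1 N := by
    have := (wnCol m).2
    rw [Fin.lt_def] at h
    rw [Finset.mem_Ico]
    omega
  exact ⟨_, hk, (mem_upperBlock hk).2 ⟨h, by omega⟩⟩

theorem exists_mem_lowerBlock {m : WNIndex N} (h : wnCol m < wnRow m) :
    ∃ k ∈ Finset.Ico 1 N, m ∈ lowerBlock N k := by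
  have hk : N - (wnRow m : ℕ) ∈ Finset.Ico 1 N := by
    have := (wnRow m).2
    rw [Fin.lt_def] at h
    rw [Finset.mem_Ico]
    omega
  exact ⟨_, hk, (mem_lowerBlock hk).2 ⟨h, by omega⟩⟩

/-- The hierarchy is equivalent to the linear system `A(u) v = a`. -/
theorem wnMatrix_mulVec_eq_iff_holds {X : Module.Basis (WNIndex N) ℂ (SLC N)}
    (hX : IsWNBasis N X) (a u v : WNIndex N → ℂ) :
    (wnMatrix X u).mulVec v = a ↔ (triangularHierarchy N).Holds a u v := by
  rw [wnMatrix_mulVec_eq_iff_parts hX, diagPart_eq_iff v (trace_conjGenerator a u)]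
  change _ ∧ _ ∧ lowerPart v = scaledLower a u * lowerFactor u ↔ _
  constructor
  · rintro ⟨h1, h2, h3⟩
    refine ⟨fun k hk i hi => ?_, fun i hi => h2 i (mem_cartanBlock.1 hi), fun k hk i hi => ?_⟩
    · rw [riccati_triangularHierarchy hk hi, ← h1,
        upperPart_apply v ((mem_upperBlock hk).1 hi).1]
    · rw [linearRhs_triangularHierarchy hk hi, ← h3,
        lowerPart_apply v ((mem_lowerBlock hk).1 hi).1]
  · intro H
    refine ⟨?_, fun m hm => H.cartan m (mem_cartanBlock.2 hm), ?_⟩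
    · ext p q
      rcases lt_or_ge p q with hpq | hpq
      · obtain ⟨m, rfl, rfl⟩ := exists_position_of_ne hpq.ne
        obtain ⟨k, hk, hm⟩ := exists_mem_upperBlock hpq
        rw [upperPart_apply v hpq, H.upper k hk m hm, riccati_triangularHierarchy hk hm]
      · rw [upperPart_eq_zero v hpq, Matrix.mul_apply, Finset.sum_eq_zero]
        intro r _
        rcases lt_or_ge r p with hr | hr
        · rw [upperFactor_eq_zero u hr, zero_mul]
        · rw [strictUpper, Matrix.of_apply, if_neg (hpq.trans hr).not_gt, mul_zero]
    · ext p q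
      rcases lt_or_ge q p with hpq | hpq
      · obtain ⟨m, rfl, rfl⟩ := exists_position_of_ne hpq.ne'
        obtain ⟨k, hk, hm⟩ := exists_mem_lowerBlock hpq
        rw [lowerPart_apply v hpq, H.lower k hk m hm, linearRhs_triangularHierarchy hk hm]
      · rw [lowerPart_eq_zero v hpq, Matrix.mul_apply, Finset.sum_eq_zero]
        intro r _
        rcases lt_or_ge r p with hr | hr
        · rw [lowerFactor_eq_zero u (hr.trans_le hpq), mul_zero]
        · rw [scaledLower_eq_zero a u hr, zero_mul]

end TriangularCoefficients

/-! ### Solving the hierarchy by quadratures -/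

section Quadrature

/-- The fundamental theorem of calculus on an open interval containing `0`. -/
theorem forall_hasDerivAt_iff_eq_integral {I : Set ℝ} (hI : IsOpen I) (hI' : I.OrdConnected)
    (h0 : 0 ∈ I) {y g : ℝ → ℂ} (hg : ContinuousOn g I) (hy : y 0 = 0) :
    (∀ t ∈ I, HasDerivAt y (g t) t) ↔ ∀ t ∈ I, y t = ∫ s in (0 : ℝ)..t, g s := by
  have hint : ∀ t ∈ I, IntervalIntegrable g MeasureTheory.volume 0 t := fun t ht =>
    (hg.mono (hI'.uIcc_subset h0 ht)).intervalIntegrable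
  constructor
  · intro h t ht
    rw [intervalIntegral.integral_eq_sub_of_hasDerivAt
      (fun s hs => h s (hI'.uIcc_subset h0 ht hs)) (hint t ht), hy, sub_zero]
  · intro h t ht
    have h1 := intervalIntegral.integral_hasDerivAt_right (hint t ht)
      (hg.stronglyMeasurableAtFilter hI t ht) (hg.continuousAt (hI.mem_nhds ht))
    exact h1.congr_of_eventuallyEq (Filter.eventually_of_mem (hI.mem_nhds ht) h)

variable {N : ℕ}

namespace WNHierarchy

theorem linearRhs_continuousOn (H : WNHierarchy N) {I : Set ℝ} {a u : ℝ → WNIndex N → ℂ}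
    (ha : ContinuousOn a I) {k : ℕ} (hk : k ∈ Finset.Ico 1 N) {i : WNIndex N}
    (hi : i ∈ lowerBlock N k)
    (hu : ∀ m ∈ upperBefore N N ∪ cartanBlock N, ContinuousOn (fun t => u t m) I)
    (hl : ∀ l ∈ Finset.Ioo k N, ∀ j ∈ lowerBlock N l, ContinuousOn (fun t => u t j) I) :
    ContinuousOn (fun t => H.linearRhs k i (a t) (u t)) I := by
  simp only [linearRhs]
  refine ((H.h_coeff k hk i hi).continuousOn ha hu).add
    (continuousOn_finsetSum _ fun l hl' => continuousOn_finsetSum _ fun j hj => ?_)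
  exact ((H.L_coeff k hk i hi l hl' j hj).continuousOn ha hu).mul (hl l hl' j hj)

/-- Solving the hierarchy block by block amounts to solving it as a system of differential
equations. -/
theorem hasDerivAt_holds_iff_solvedOn (H : WNHierarchy N) {I : Set ℝ} (hI : IsOpen I)
    (hI' : I.OrdConnected) (h0 : 0 ∈ I) {a u : ℝ → WNIndex N → ℂ} (ha : ContinuousOn a I)
    (hu0 : u 0 = 0) :
    (∀ t ∈ I, ∃ v, HasDerivAt u v t ∧ H.Holds (a t) (u t) v) ↔ H.SolvedOn a u I := by
  have hu0' : ∀ i, u 0 i = 0 := fun i => by rw [hu0]; rfl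
  constructor
  · intro h
    have hc : ∀ i, ContinuousOn (fun t => u t i) I := fun i t ht => by
      obtain ⟨v, hv, -⟩ := h t ht
      exact (hasDerivAt_pi.1 hv i).continuousAt.continuousWithinAt
    refine ⟨fun k hk i hi t ht => ?_, fun i hi => ?_, fun k hk i hi => ?_⟩
    · obtain ⟨v, hv, hH⟩ := h t ht
      rw [← hH.upper k hk i hi]
      exact hasDerivAt_pi.1 hv i
    · refine (forall_hasDerivAt_iff_eq_integral hI hI' h0
        ((H.f_coeff i hi).continuousOn ha fun j _ => hc j) (hu0' i)).1 fun t ht => ?_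
      obtain ⟨v, hv, hH⟩ := h t ht
      rw [← hH.cartan i hi]
      exact hasDerivAt_pi.1 hv i
    · refine (forall_hasDerivAt_iff_eq_integral hI hI' h0
        (H.linearRhs_continuousOn ha hk hi (fun j _ => hc j) fun _ _ j _ => hc j)
        (hu0' i)).1 fun t ht => ?_
      obtain ⟨v, hv, hH⟩ := h t ht
      rw [← hH.lower k hk i hi]
      exact hasDerivAt_pi.1 hv i
  · intro h
    have cont : ∀ {i : WNIndex N} {g : ℝ → ℂ}, (∀ t ∈ I, HasDerivAt (fun s => u s i) (g t) t) →
        ContinuousOn (fun t => u t i) I := fun hg t ht =>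
      (hg t ht).continuousAt.continuousWithinAt
    have hup : ∀ i ∈ upperBefore N N, ContinuousOn (fun t => u t i) I := fun i hi => by
      obtain ⟨k, hk, hik⟩ := Finset.mem_biUnion.1 hi
      exact cont (h.upper k hk i hik)
    have hdiag : ∀ i ∈ cartanBlock N, ∀ t ∈ I,
        HasDerivAt (fun s => u s i) (H.f i (a t) (u t)) t := fun i hi =>
      (forall_hasDerivAt_iff_eq_integral hI hI' h0 ((H.f_coeff i hi).continuousOn ha hup)
        (hu0' i)).2 (h.cartan i hi)
    have hupd : ∀ m ∈ upperBefore N N ∪ cartanBlock N, ContinuousOn (fun t => u t m) I := by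
      intro m hm
      rcases Finset.mem_union.1 hm with hm | hm
      · exact hup m hm
      · exact cont (hdiag m hm)
    -- the rows of the lower blocks become continuous one after the other, from the top
    have hlow : ∀ d k, k + d = N → k ∈ Finset.Ico 1 N → ∀ i ∈ lowerBlock N k, ∀ t ∈ I,
        HasDerivAt (fun s => u s i) (H.linearRhs k i (a t) (u t)) t := by
      intro d
      induction d using Nat.strong_induction_on with
      | _ d ih =>
        intro k hd hk i hi
        refine (forall_hasDerivAt_iff_eq_integral hI hI' h0
          (H.linearRhs_continuousOn ha hk hi hupd fun l hl j hj => ?_)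
          (hu0' i)).2 (h.lower k hk i hi)
        obtain ⟨hl1, hl2⟩ := Finset.mem_Ioo.1 hl
        have := (Finset.mem_Ico.1 hk).1
        exact cont (ih (N - l) (by omega) l (by omega) (Finset.mem_Ico.2 ⟨by omega, hl2⟩) j hj)
    have hlow' : ∀ k ∈ Finset.Ico 1 N, ∀ i ∈ lowerBlock N k, ∀ t ∈ I,
        HasDerivAt (fun s => u s i) (H.linearRhs k i (a t) (u t)) t := fun k hk =>
      hlow (N - k) k (by have := (Finset.mem_Ico.1 hk).2; omega) hk
    intro t ht
    refine ⟨fun i => deriv (fun s => u s i) t, hasDerivAt_pi.2 fun i => ?_,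
      fun k hk i hi => (h.upper k hk i hi t ht).deriv, fun i hi => (hdiag i hi t ht).deriv,
      fun k hk i hi => (hlow' k hk i hi t ht).deriv⟩
    rcases lt_trichotomy (wnRow i) (wnCol i) with hi | hi | hi
    · obtain ⟨k, hk, hik⟩ := exists_mem_upperBlock hi
      exact (h.upper k hk i hik t ht).differentiableAt.hasDerivAt
    · exact (hdiag i (mem_cartanBlock.2 hi) t ht).differentiableAt.hasDerivAt
    · obtain ⟨k, hk, hik⟩ := exists_mem_lowerBlock hi
      exact (hlow' k hk i hik t ht).differentiableAt.hasDerivAt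

end WNHierarchy

end Quadrature

/-! ### The basis and the Wei–Norman matrix -/

section Basis

variable {N : ℕ}

theorem generatorMatrix_upper (a : WNIndex N → ℂ) {p q : Fin N} (h : p < q) :
    generatorMatrix a p q = upperPart a p q := by
  simp [generatorMatrix_eq, lowerPart_eq_zero a h.le, Matrix.diagonal_apply_ne _ h.ne]

theorem generatorMatrix_lower (a : WNIndex N → ℂ) {p q : Fin N} (h : q < p) :
    generatorMatrix a p q = lowerPart a p q := by
  simp [generatorMatrix_eq, upperPart_eq_zero a h.le, Matrix.diagonal_apply_ne _ h.ne']

theorem generatorMatrix_diag (a : WNIndex N → ℂ) (p : Fin N) :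
    generatorMatrix a p p = diagPart a p := by
  simp [generatorMatrix_eq, upperPart_eq_zero, lowerPart_eq_zero]

/-- The coordinate of a matrix with respect to the basis element with number `m + 1`. -/
noncomputable def wnCoordinate (A : Matrix (Fin N) (Fin N) ℂ) (m : WNIndex N) : ℂ :=
  if wnRow m = wnCol m then ∑ i ∈ Finset.Iic (wnRow m), A i i else A (wnRow m) (wnCol m)

theorem wnCoordinate_generatorMatrix (a : WNIndex N → ℂ) :
    wnCoordinate (generatorMatrix a) = a := by
  ext m
  rw [wnCoordinate]
  rcases lt_trichotomy (wnRow m) (wnCol m) with h | h | h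
  · rw [if_neg h.ne, generatorMatrix_upper a h, upperPart_apply a h]
  · simp only [if_pos h, generatorMatrix_diag]
    exact sum_diagPart_Iic a h
  · rw [if_neg h.ne', generatorMatrix_lower a h, lowerPart_apply a h]

theorem generatorMatrix_wnCoordinate {A : Matrix (Fin N) (Fin N) ℂ} (hA : A.trace = 0) :
    generatorMatrix (wnCoordinate A) = A := by
  have hd : diagPart (wnCoordinate A) = fun i => A i i :=
    (diagPart_eq_iff _ hA).2 fun m hm => by
      rw [wnCoordinate, if_pos hm]
      rfl
  ext p q
  rcases lt_trichotomy p q with h | rfl | h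
  · obtain ⟨m, rfl, rfl⟩ := exists_position_of_ne h.ne
    rw [generatorMatrix_upper _ h, upperPart_apply _ h, wnCoordinate, if_neg h.ne]
  · rw [generatorMatrix_diag, hd]
  · obtain ⟨m, rfl, rfl⟩ := exists_position_of_ne h.ne'
    rw [generatorMatrix_lower _ h, lowerPart_apply _ h, wnCoordinate, if_neg h.ne']

/-- The coordinates on `sl(N, ℂ)`. -/
noncomputable def wnCoordinateEquiv (N : ℕ) : SLC N ≃ₗ[ℂ] (WNIndex N → ℂ) :=
  LinearEquiv.symm
    { toFun := fun a => ⟨generatorMatrix a, LinearMap.mem_ker.2 (trace_generatorMatrix a)⟩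
      map_add' := fun a b => Subtype.ext (map_add generatorMatrix a b)
      map_smul' := fun c a => Subtype.ext (map_smul generatorMatrix c a)
      invFun := fun A => wnCoordinate A
      left_inv := wnCoordinate_generatorMatrix
      right_inv := fun A => Subtype.ext (generatorMatrix_wnCoordinate (LinearMap.mem_ker.1 A.2)) }

theorem existsUnique_isWNBasis (N : ℕ) :
    ∃! X : Module.Basis (WNIndex N) ℂ (SLC N), IsWNBasis N X := by
  have h : IsWNBasis N (Module.Basis.ofEquivFun (wnCoordinateEquiv N)) :=
    (isWNBasis_iff _).2 fun m => by
      rw [Module.Basis.coe_ofEquivFun]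
      rfl
  refine ⟨_, h, fun Y hY => Module.Basis.eq_of_apply_eq fun m => Subtype.ext ?_⟩
  rw [(isWNBasis_iff Y).1 hY, (isWNBasis_iff _).1 h]

theorem isUnit_wnMatrix {X : Module.Basis (WNIndex N) ℂ (SLC N)} (hX : IsWNBasis N X)
    (u : WNIndex N → ℂ) : IsUnit (wnMatrix X u) := by
  rw [← Matrix.mulVec_injective_iff_isUnit]
  refine (injective_iff_map_eq_zero (Matrix.mulVecLin (wnMatrix X u))).2 fun v hv => ?_
  obtain ⟨h1, h2, h3⟩ := (wnMatrix_mulVec_eq_iff_parts hX 0 u v).1 hv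
  have hB : conjGenerator 0 u = 0 := by simp [conjGenerator]
  have hU : strictUpper (0 : Matrix (Fin N) (Fin N) ℂ) = 0 := by
    ext
    simp [strictUpper]
  have hL : strictLower (0 : Matrix (Fin N) (Fin N) ℂ) = 0 := by
    ext
    simp [strictLower]
  rw [hB, hU, mul_zero] at h1
  rw [hB, hL, mul_zero, zero_mul, zero_mul] at h3
  rw [hB] at h2
  have h : generatorMatrix v = 0 := by
    rw [generatorMatrix_eq, h1, h2, h3]
    simp
  rw [← wnCoordinate_generatorMatrix v, h]
  ext m
  simp [wnCoordinate]

theorem eq_inv_mulVec_iff {X : Module.Basis (WNIndex N) ℂ (SLC N)} (hX : IsWNBasis N X)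
    (a u v : WNIndex N → ℂ) :
    v = (wnMatrix X u)⁻¹.mulVec a ↔ (wnMatrix X u).mulVec v = a := by
  have h := (Matrix.isUnit_iff_isUnit_det _).1 (isUnit_wnMatrix hX u)
  constructor
  · rintro rfl
    rw [Matrix.mulVec_mulVec, Matrix.mul_nonsing_inv _ h, Matrix.one_mulVec]
  · rintro rfl
    rw [Matrix.mulVec_mulVec, Matrix.nonsing_inv_mul _ h, Matrix.one_mulVec]

end Basis

/-! ### Restriction to `su(N)` -/

section Unitary

variable {N : ℕ}

theorem diagPart_star (a : WNIndex N → ℂ) (i : Fin N) :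
    star (diagPart a i) = diagPart (star a) i := by
  simp only [diagPart, Fintype.linearCombination_apply, Finset.sum_apply, Pi.smul_apply,
    star_sum, smul_eq_mul, star_mul', Pi.star_apply]
  refine Finset.sum_congr rfl fun m _ => ?_
  congr 1
  split_ifs
  · simp only [cartanVector]
    split_ifs <;> simp
  · simp

theorem conjTranspose_generatorMatrix_eq_neg_iff (a : WNIndex N → ℂ) :
    (generatorMatrix a).conjTranspose = -generatorMatrix a ↔
      (∀ m ∈ upperBefore N N, a m.rev = -star (a m)) ∧
      (∀ m ∈ cartanBlock N, star (a m) = -a m) := by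
  have hrev : ∀ {m : WNIndex N}, wnRow m < wnCol m →
      generatorMatrix a (wnCol m) (wnRow m) = a m.rev := fun {m} hm => by
    obtain ⟨h1, h2⟩ := position_rev hm
    rw [generatorMatrix_lower a hm, ← h1, ← h2, lowerPart_apply a (by rwa [h1, h2])]
  have hup : ∀ {m : WNIndex N}, wnRow m < wnCol m →
      generatorMatrix a (wnRow m) (wnCol m) = a m := fun {m} hm => by
    rw [generatorMatrix_upper a hm, upperPart_apply a hm]
  constructor
  · intro h
    have h' : ∀ p q, star (generatorMatrix a p q) = -generatorMatrix a q p := fun p q => by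
      rw [← Matrix.conjTranspose_apply, h, Matrix.neg_apply]
    refine ⟨fun m hm => ?_, fun m hm => ?_⟩
    · rw [mem_upperBefore_self] at hm
      rw [← hrev hm, ← hup hm, h', neg_neg]
    · rw [← sum_diagPart_Iic a (mem_cartanBlock.1 hm), star_sum, ← Finset.sum_neg_distrib]
      exact Finset.sum_congr rfl fun i _ => by rw [← generatorMatrix_diag, h']
  · rintro ⟨h1, h2⟩
    ext p q
    rw [Matrix.conjTranspose_apply, Matrix.neg_apply]
    rcases lt_trichotomy p q with h | rfl | h
    · obtain ⟨m, rfl, rfl⟩ := exists_position_of_ne h.ne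
      rw [hrev h, hup h, h1 m (mem_upperBefore_self.2 h), star_neg, star_star]
    · rw [generatorMatrix_diag, diagPart_star, ← Pi.neg_apply, ← map_neg]
      refine congrFun (?_ : diagPart (star a) = diagPart (-a)) p
      simp only [diagPart, Fintype.linearCombination_apply]
      refine Finset.sum_congr rfl fun m _ => ?_
      split_ifs with hm
      · rw [Pi.star_apply, h2 m (mem_cartanBlock.2 hm), Pi.neg_apply]
      · simp
    · obtain ⟨m, rfl, rfl⟩ := exists_position_of_ne h.ne
      rw [hup h, hrev h, h1 m (mem_upperBefore_self.2 h), neg_neg]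

theorem det_wnProduct {X : Module.Basis (WNIndex N) ℂ (SLC N)} (hX : IsWNBasis N X)
    (u : WNIndex N → ℂ) : (wnProduct X u).det = 1 := by
  rw [wnProduct_eq hX, Matrix.det_mul, Matrix.det_mul, det_upperFactor, det_diagFactor,
    det_lowerFactor, one_mul, one_mul]

open scoped Matrix.Norms.Operator in
/-- A solution of `K' = M K` with `M` anti-Hermitian stays unitary, since the derivative of `Kᴴ K`
vanishes. -/
theorem mem_unitaryGroup_of_hasDerivAt {I : Set ℝ} (hI : IsOpen I) (hI' : I.OrdConnected)
    (h0 : 0 ∈ I) {K M : ℝ → Matrix (Fin N) (Fin N) ℂ}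
    (hK : ∀ t ∈ I, HasDerivAt K (M t * K t) t) (hM : ∀ t ∈ I, (M t).conjTranspose = -M t)
    (hK0 : K 0 = 1) {t : ℝ} (ht : t ∈ I) : K t ∈ Matrix.unitaryGroup (Fin N) ℂ := by
  have : @ContinuousStar (Matrix (Fin N) (Fin N) ℂ)
      PseudoMetricSpace.toUniformSpace.toTopologicalSpace _ :=
    ⟨continuous_id.matrix_conjTranspose⟩
  have hd : ∀ s ∈ I, HasDerivAt (fun s => star (K s) * K s) 0 s := by
    intro s hs
    have h1 : HasDerivAt (fun s => star (K s)) (star (M s * K s)) s := HasDerivAt.star (hK s hs)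
    have h2 := h1.matrix_mul (hK s hs)
    have h3 : star (M s * K s) * K s + star (K s) * (M s * K s) = 0 := by
      rw [star_mul, Matrix.star_eq_conjTranspose (M s), hM s hs]
      noncomm_ring
    rwa [h3] at h2
  obtain ⟨C, hC⟩ := hI.exists_is_const_of_deriv_eq_zero hI'.isPreconnected
    (f := fun s => star (K s) * K s)
    (fun s hs => (hd s hs).differentiableAt.differentiableWithinAt) (fun s hs => (hd s hs).deriv)
  rw [Matrix.mem_unitaryGroup_iff']
  have h1 := hC t ht
  have h2 := hC 0 h0
  rw [h1, ← h2, hK0, star_one, one_mul]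

end Unitary

/-! ### The theorem on the Wei–Norman system of `sl(N, ℂ)` -/

theorem mainTheorem1 (N : ℕ) (hN : 2 ≤ N) :
    (∃! X : Module.Basis (WNIndex N) ℂ (SLC N), IsWNBasis N X) ∧
    ∀ X : Module.Basis (WNIndex N) ℂ (SLC N), IsWNBasis N X →
      -- the Wei-Norman matrix is invertible, and the Wei-Norman system is the equation for `K`
      (∀ u : WNIndex N → ℂ, IsUnit (wnMatrix X u)) ∧
      (∀ (a : WNIndex N → ℂ) (u : ℝ → WNIndex N → ℂ) (v : WNIndex N → ℂ) (t : ℝ),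
        HasDerivAt u v t →
          (HasDerivAt (fun s => wnProduct X (u s)) (wnGenerator X a * wnProduct X (u t)) t ↔
            v = (wnMatrix X (u t))⁻¹.mulVec a)) ∧
      -- the Wei-Norman system is a hierarchy
      (∃ H : WNHierarchy N,
        (∀ a u v : WNIndex N → ℂ, v = (wnMatrix X u)⁻¹.mulVec a ↔ H.Holds a u v) ∧
        (∀ (I : Set ℝ), IsOpen I → I.OrdConnected → 0 ∈ I →
          ∀ a u : ℝ → WNIndex N → ℂ, ContinuousOn a I → u 0 = 0 →
            ((∀ t ∈ I, HasDerivAt u ((wnMatrix X (u t))⁻¹.mulVec (a t)) t) ↔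
              H.SolvedOn a u I))) ∧
      -- the initial condition, and the restriction to `su(N)`
      wnProduct X 0 = 1 ∧
      (∀ a : WNIndex N → ℂ, (wnGenerator X a).conjTranspose = -wnGenerator X a ↔
        (∀ m ∈ upperBefore N N, a m.rev = -star (a m)) ∧
        (∀ m ∈ cartanBlock N, star (a m) = -a m)) ∧
      (∀ (I : Set ℝ), IsOpen I → I.OrdConnected → 0 ∈ I →
        ∀ a u : ℝ → WNIndex N → ℂ, u 0 = 0 →
          (∀ t ∈ I, HasDerivAt u ((wnMatrix X (u t))⁻¹.mulVec (a t)) t) →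
          (∀ t ∈ I, (wnGenerator X (a t)).conjTranspose = -wnGenerator X (a t)) →
          ∀ t ∈ I, wnProduct X (u t) ∈ Matrix.specialUnitaryGroup (Fin N) ℂ) := by

  refine ⟨existsUnique_isWNBasis N, fun X hX => ⟨isUnit_wnMatrix hX, fun a u v t hu => ?_,
    ⟨triangularHierarchy N, fun a u v => ?_, fun I hI hI' h0 a u ha hu0 => ?_⟩,
    wnProduct_zero X, fun a => ?_, fun I hI hI' h0 a u hu0 hu hM t ht => ?_⟩⟩
  · rw [hasDerivAt_wnProduct_iff X hu, eq_inv_mulVec_iff hX]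
  · rw [eq_inv_mulVec_iff hX, wnMatrix_mulVec_eq_iff_holds hX]
  · rw [← WNHierarchy.hasDerivAt_holds_iff_solvedOn _ hI hI' h0 ha hu0]
    refine forall₂_congr fun t _ => ?_
    simp only [← wnMatrix_mulVec_eq_iff_holds hX, ← eq_inv_mulVec_iff hX, exists_eq_right]
  · rw [wnGenerator_eq hX, conjTranspose_generatorMatrix_eq_neg_iff]
  · refine Matrix.mem_specialUnitaryGroup_iff.2 ⟨?_, det_wnProduct hX (u t)⟩
    refine mem_unitaryGroup_of_hasDerivAt hI hI' h0 (K := fun s => wnProduct X (u s))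
      (M := fun s => wnGenerator X (a s)) (fun s hs => ?_) hM (by rw [hu0, wnProduct_zero]) ht
    rw [hasDerivAt_wnProduct_iff X (hu s hs), ← eq_inv_mulVec_iff hX]
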